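/- Let $n\ge 1$ and let $\sigma$ be a probability distribution on $[n]=\{1,\dots,n\}$; write $\sigma_{\le i}:=\Pr_{i^*\sim\sigma}[i^*\le i]$ and assume $\sigma_{\le i}>\frac in$ for all $i\in[n-1]$. Consider the $\sigma$-MultiQueue: the elements of an infinite set $\{x_1<x_2<\dots\}$ are distributed over $n$ queues, each element being put into a uniformly random queue, independently of the others. Then deletions are performed one after the other: in each step the queues are indexed such that their minima (top-elements) are in ascending order, $\min Q_1<\dots<\min Q_n$, an index $i\in[n]$ is sampled from $\sigma$ (independently of everything else), and $\min Q_i$ is deleted from $Q_i$. The rank error of the deletion is $r-1$, where $r$ is the rank of the deleted element among all elements present in the queues immediately before the deletion. Let $E^{(s)}$ denote the rank error exhibited by the deletion in step $s$. Let $\delta_1,\dots,\delta_{n-1}$ be independent random variables with $\delta_i\sim\mathrm{Geom}_1\bigl(1-\frac{i}{n\sigma_{\le i}}\bigr)$, where $\mathrm{Geom}_1(p)$ is the distribution of the number of Bernoulli trials with success probability $p$ until and including the first success; let $r_i=1+\sum_{j=1}^{i-1}\delta_j$ for $i\in[n]$, let $i^*\sim\sigma$ be independent of $(\delta_1,\dots,\delta_{n-1})$,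 and let $E=r_{i^*}-1$. Then, as $s\to\infty$, $E^{(s)}$ converges in distribution to $E$. Moreover, the expectation of $E$ (the expected rank error in the long run, i.e. after convergence) is finite and equals \[ \mathbb E[E]=\sum_{i=1}^{n-1}\frac{\sigma_{\le i}\,(1-\sigma_{\le i})}{\sigma_{\le i}-\frac in}. \] -/

import Mathlib

open MeasureTheory ProbabilityTheory Filter

noncomputable section

namespace MultiQueue

/-! ### The deletion process

The elements are the natural numbers (only their order matters).  A configuration is a family
`Q : Fin n → Set ℕ` of queues, each identified with the set of elements it contains; the
(zero-based) index `i : Fin n` stands for the `(i + 1)`-st queue. -/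

/-- The top-element (minimum) of the `i`-th queue. -/
def top {n : ℕ} (Q : Fin n → Set ℕ) (i : Fin n) : ℕ := sInf (Q i)

/-- Relabel the queues such that their top-elements appear in ascending order. -/
def relabel {n : ℕ} (Q : Fin n → Set ℕ) : Fin n → Set ℕ :=
  fun i => Q (Tuple.sort (top Q) i)

/-- Delete the top-element of the `i`-th queue (without relabelling). -/
def deleteTop {n : ℕ} (Q : Fin n → Set ℕ) (i : Fin n) : Fin n → Set ℕ :=
  Function.update Q i (Q i \ {top Q i})

/-- The queues after `s` deletions, in ascending order of their top-elements, if element `k` is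
initially put into the queue with label `a k`, and the `(t + 1)`-st deletion selects the
queue with index `c t`. -/
def queues {n : ℕ} (a : ℕ → Fin n) (c : ℕ → Fin n) : ℕ → Fin n → Set ℕ
  | 0 => relabel (fun j => {k | a k = j})
  | s + 1 => relabel (deleteTop (queues a c s) (c s))

/-- The rank of the top-element of the `i`-th queue among all elements of all queues. -/
def topRank {n : ℕ} (Q : Fin n → Set ℕ) (i : Fin n) : ℕ :=
  {y | y ∈ ⋃ j, Q j ∧ y ≤ top Q i}.ncard

/-- The rank error of the deletion that is performed after `s` deletions have taken place:
the rank of the deleted element minus one. -/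
def rankError {n : ℕ} (a : ℕ → Fin n) (c : ℕ → Fin n) (s : ℕ) : ℕ :=
  topRank (queues a c s) (c s) - 1

/-- The randomness of a `σ`-MultiQueue: the elements are partitioned randomly, i.e. each element is
put into a uniformly random queue, independently of the others, and the indices selected by the
deletions are independent samples of `σ`, independent of the partition. -/
structure IsInput {n : ℕ} (σ : PMF (Fin n)) {Ω : Type*} [MeasurableSpace Ω] (μ : Measure Ω)
    (A : ℕ → Ω → Fin n) (I : ℕ → Ω → Fin n) : Prop where
  law_element : ∀ k, HasLaw (A k) (uniformOn (Set.univ : Set (Fin n))) μ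
  law_choice : ∀ s, HasLaw (I s) σ.toMeasure μ
  indep : iIndepFun (Sum.elim A I) μ

/-! ### The limiting distribution -/

/-- `σ_{≤ i}`: the probability that `σ` selects one of the first `i` queues. -/
def cum {n : ℕ} (σ : PMF (Fin n)) (i : ℕ) : ℝ :=
  ∑ j : Fin n with j.val < i, (σ j).toReal

/-- The condition `σ_{≤ i} > i / n` for all `1 ≤ i ≤ n - 1`. -/
def Star {n : ℕ} (σ : PMF (Fin n)) : Prop :=
  ∀ i : ℕ, 1 ≤ i → i ≤ n - 1 → (i : ℝ) / n < cum σ i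

/-- The number `1 - i / (n σ_{≤ i})` for `i = j + 1`, as an element of the unit interval. -/
def successProb {n : ℕ} (σ : PMF (Fin n)) (hσ : Star σ) (j : Fin (n - 1)) : unitInterval :=
  ⟨1 - ((j.val + 1 : ℕ) : ℝ) / (n * cum σ (j.val + 1)), by
    have hj := j.isLt
    have h := hσ (j.val + 1) (by omega) (by omega)
    have hn : (0 : ℝ) < n := by
      have : 0 < n := by omega
      exact_mod_cast this
    rw [div_lt_iff₀ hn] at h
    have hi : (0 : ℝ) < ((j.val + 1 : ℕ) : ℝ) := by positivity
    have hc : 0 < (n : ℝ) * cum σ (j.val + 1) := by linarith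
    constructor
    · have : ((j.val + 1 : ℕ) : ℝ) / (n * cum σ (j.val + 1)) ≤ 1 := by
        rw [div_le_one hc]; linarith
      linarith
    · have : 0 ≤ ((j.val + 1 : ℕ) : ℝ) / (n * cum σ (j.val + 1)) := by positivity
      linarith⟩

/-- The geometric distribution of the number of Bernoulli trials with success probability `p` until
and including the first success. -/
def geomOne (p : unitInterval) : Measure ℕ := (geometricMeasure p).map (fun k => k + 1)

/-- `r_i = 1 + ∑_{j < i} δ_j`. -/
def limitRank {n : ℕ} (d : Fin (n - 1) → ℕ) (i : Fin n) : ℕ :=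
  1 + ∑ j : Fin (n - 1) with j.val < i.val, d j

end MultiQueue

end

/-!
Only the order of the present elements matters, so a configuration is encoded by the word
`w : ℕ → Fin n` of the labels of the present elements in ascending order. The queue with the
`i`-th smallest top-element is the one whose label is the `i`-th distinct letter of `w`, a deletion
from it removes the first occurrence of that letter (`delPos`), and the rank error is the position
of this occurrence (`pos`, `rankError_eq_pos`). Initially the letters are independent and uniform
(`iid`), so the law of the word evolves by the Markov operator `step σ`.

*Stationarity.* Let `weight` be the product of `1 / σ_{≤ a}` over all positions whose letter has
occurred before, `a` being the number of distinct letters seen so far. A deletion undoes the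
insertion of a letter, and inserting a uniform letter at a fixed position preserves `iid`. So the
measure with density `weight` is stationary as soon as, for every letter `x`, the sum of the weights
over all insertions of `x` before its first occurrence, weighted with the probability of undoing
the insertion, is the weight of the word. This sum telescopes (`tsum_ins_add`). The condition
`σ_{≤ i} > i / n` makes `weight` integrable. Under the resulting distribution `stat`, the number of
distinct letters in a prefix is a pure birth chain that stays in `a` with probability
`a / (n σ_{≤ a})`, so that the positions of the first occurrences are sums of independent geometric
variables (`map_pos_stat`).

*Convergence.* In all laws that occur, the letters following a prefix that contains every letter
are independent of this prefix and uniform (`FreshSuffix`), since a deletion takes place inside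
such a prefix. As `σ` selects the first queue with positive probability, and deleting from it `k`
times drops the first `k` letters, the law is renewed to `iid` within `k` steps with probability
bounded below, on the words whose first `k` letters contain every letter
(`exists_iterate_step_eq_smul_iid`). The other words stay unlikely uniformly in time, because
`weight ≥ 1` bounds `iid`, and hence all its iterates, by a multiple of `stat`. Removing common
parts repeatedly shows that the law of the word converges to `stat` on every set
(`tendsto_iterate_step`).
-/

namespace MultiQueue

open scoped ENNReal

variable {n : ℕ}

/-! ### Words -/

/-- The word `x w₀ w₁ w₂ …`. -/
def cons (x : Fin n) (w : ℕ → Fin n) : ℕ → Fin n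
  | 0 => x
  | k + 1 => w k

/-- The word `w` without its first `k` letters. -/
def drop (k : ℕ) (w : ℕ → Fin n) : ℕ → Fin n := fun j => w (k + j)

/-- The word `w` with the letter `x` inserted at position `q`. -/
def ins (q : ℕ) (x : Fin n) (w : ℕ → Fin n) : ℕ → Fin n :=
  fun k => if k < q then w k else if k = q then x else w (k - 1)

/-- The word `w` with its letter at position `q` deleted. -/
def del (q : ℕ) (w : ℕ → Fin n) : ℕ → Fin n := fun k => if k < q then w k else w (k + 1)

/-- The letters in `A` together with the first `k` letters of `w`. -/
def seen (A : Finset (Fin n)) (w : ℕ → Fin n) (k : ℕ) : Finset (Fin n) :=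
  A ∪ (Finset.range k).image w

/-- The position of the first occurrence of the `i`-th distinct letter of `w`, both counted from
zero: the least position up to which more than `i` distinct letters occur. It is `0` if `w` has at
most `i` distinct letters. -/
noncomputable def pos (i : ℕ) (w : ℕ → Fin n) : ℕ := sInf {q | i < (seen ∅ w (q + 1)).card}

/-- The word `w` without the first occurrence of its `i`-th distinct letter. -/
noncomputable def delPos (i : ℕ) (w : ℕ → Fin n) : ℕ → Fin n := del (pos i w) w

@[simp] lemma cons_zero (x : Fin n) (w : ℕ → Fin n) : cons x w 0 = x := rfl

@[simp] lemma cons_succ (x : Fin n) (w : ℕ → Fin n) (k : ℕ) : cons x w (k + 1) = w k := rfl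

lemma cons_drop_one (w : ℕ → Fin n) : cons (w 0) (drop 1 w) = w := by
  funext k
  cases k with
  | zero => rfl
  | succ k => simp [drop, add_comm]

@[simp] lemma drop_one_cons (x : Fin n) (w : ℕ → Fin n) : drop 1 (cons x w) = w := by
  funext k
  simp [drop, add_comm 1 k]

@[simp] lemma drop_zero (w : ℕ → Fin n) : drop 0 w = w := by
  funext k
  simp [drop]

lemma drop_succ_cons (k : ℕ) (x : Fin n) (w : ℕ → Fin n) : drop (k + 1) (cons x w) = drop k w := by
  funext j
  simp [drop, show k + 1 + j = (k + j) + 1 by omega]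

lemma drop_drop (j k : ℕ) (w : ℕ → Fin n) : drop j (drop k w) = drop (k + j) w := by
  funext i
  simp [drop, add_assoc]

lemma ins_zero (x : Fin n) (w : ℕ → Fin n) : ins 0 x w = cons x w := by
  funext k
  cases k <;> simp [ins]

lemma ins_succ_cons (q : ℕ) (x y : Fin n) (w : ℕ → Fin n) :
    ins (q + 1) x (cons y w) = cons y (ins q x w) := by
  funext k
  rcases k with _ | _ | k
  · simp [ins]
  · rcases q with _ | q <;> simp [ins]
  · simp [ins]

lemma del_ins (q : ℕ) (x : Fin n) (w : ℕ → Fin n) : del q (ins q x w) = w := by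
  funext k
  by_cases h : k < q
  · simp [del, ins, h]
  · simp [del, ins, h, show ¬ k + 1 < q by omega, show k + 1 ≠ q by omega]

lemma mem_seen {A : Finset (Fin n)} {w : ℕ → Fin n} {k : ℕ} {x : Fin n} :
    x ∈ seen A w k ↔ x ∈ A ∨ ∃ j < k, w j = x := by
  simp [seen]

@[simp] lemma seen_zero (A : Finset (Fin n)) (w : ℕ → Fin n) : seen A w 0 = A := by
  simp [seen]

lemma seen_succ (A : Finset (Fin n)) (w : ℕ → Fin n) (k : ℕ) :
    seen A w (k + 1) = insert (w k) (seen A w k) := by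
  ext x
  simp only [mem_seen, Finset.mem_insert, Nat.lt_succ_iff_lt_or_eq]
  constructor
  · rintro (h | ⟨j, h | rfl, rfl⟩)
    · exact .inr (.inl h)
    · exact .inr (.inr ⟨j, h, rfl⟩)
    · exact .inl rfl
  · rintro (rfl | h | ⟨j, h, rfl⟩)
    · exact .inr ⟨k, .inr rfl, rfl⟩
    · exact .inl h
    · exact .inr ⟨j, .inl h, rfl⟩

lemma seen_mono (A : Finset (Fin n)) (w : ℕ → Fin n) : Monotone (seen A w) :=
  monotone_nat_of_le_succ fun k => by rw [seen_succ]; exact Finset.subset_insert _ _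

lemma seen_cons_succ (A : Finset (Fin n)) (x : Fin n) (w : ℕ → Fin n) (k : ℕ) :
    seen A (cons x w) (k + 1) = seen (insert x A) w k := by
  induction k with
  | zero => simp [seen_succ]
  | succ k ih => rw [seen_succ, ih, cons_succ, seen_succ]

lemma seen_congr {A : Finset (Fin n)} {v w : ℕ → Fin n} {k : ℕ} (h : ∀ j < k, v j = w j) :
    seen A v k = seen A w k := by
  ext x
  simp only [mem_seen]
  exact or_congr_right ⟨fun ⟨j, hj, e⟩ => ⟨j, hj, by rw [← h j hj, e]⟩,
    fun ⟨j, hj, e⟩ => ⟨j, hj, by rw [h j hj, e]⟩⟩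

lemma exists_seen_eq_univ {w : ℕ → Fin n} (hw : ∀ x, ∃ k, w k = x) :
    ∃ k, seen ∅ w k = Finset.univ := by
  choose k hk using hw
  refine ⟨Finset.univ.sup k + 1, Finset.eq_univ_of_forall fun x => ?_⟩
  refine mem_seen.2 (.inr ⟨k x, ?_, hk x⟩)
  exact Nat.lt_succ_of_le (Finset.le_sup (Finset.mem_univ x))

/-! ### The position of the distinct letters -/

lemma pos_set_nonempty {w : ℕ → Fin n} {k i : ℕ} (hk : i < (seen ∅ w k).card) :
    ∃ q, q + 1 = k ∧ i < (seen ∅ w (q + 1)).card := by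
  rcases k with _ | k
  · simp at hk
  · exact ⟨k, rfl, hk⟩

lemma pos_lt_of_lt_card {w : ℕ → Fin n} {k i : ℕ} (hk : i < (seen ∅ w k).card) :
    pos i w < k := by
  obtain ⟨q, rfl, hq⟩ := pos_set_nonempty hk
  exact Nat.lt_succ_of_le (Nat.sInf_le hq)

lemma pos_lt_of_seen {w : ℕ → Fin n} {k : ℕ} (i : Fin n) (hk : seen ∅ w k = Finset.univ) :
    pos i w < k :=
  pos_lt_of_lt_card (by simp [hk])

lemma lt_card_of_pos_lt {w : ℕ → Fin n} {i m k : ℕ} (hm : i < (seen ∅ w m).card)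
    (hk : pos i w < k) : i < (seen ∅ w k).card := by
  obtain ⟨q, rfl, hq⟩ := pos_set_nonempty hm
  have h : i < (seen ∅ w (pos i w + 1)).card :=
    Nat.sInf_mem (s := {q | i < (seen ∅ w (q + 1)).card}) ⟨q, hq⟩
  exact h.trans_le (Finset.card_le_card (seen_mono _ _ hk))

/-- `k ≤ pos i w` iff at most `i` distinct letters occur before position `k`. -/
lemma le_pos_iff {w : ℕ → Fin n} (hw : ∀ x, ∃ k, w k = x) (i : Fin n) (k : ℕ) :
    k ≤ pos i w ↔ (seen ∅ w k).card ≤ i := by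
  obtain ⟨m, hm⟩ := exists_seen_eq_univ hw
  rw [← not_lt, ← not_lt, not_iff_not]
  exact ⟨lt_card_of_pos_lt (m := m) (by simp [hm]), pos_lt_of_lt_card⟩

lemma pos_zero (w : ℕ → Fin n) : pos 0 w = 0 :=
  Nat.lt_one_iff.1 (pos_lt_of_lt_card (by simp [seen_succ]))

lemma delPos_zero (w : ℕ → Fin n) : delPos 0 w = drop 1 w := by
  funext k
  simp [delPos, pos_zero, del, drop, add_comm]

lemma pos_congr {v w : ℕ → Fin n} {k : ℕ} (i : Fin n) (h : ∀ j < k, v j = w j)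
    (hv : seen ∅ v k = Finset.univ) : pos i v = pos i w := by
  have hw : seen ∅ w k = Finset.univ := by rw [← seen_congr h, hv]
  have key : ∀ {u u' : ℕ → Fin n}, (∀ j < k, u j = u' j) → seen ∅ u k = Finset.univ →
      pos i u ≤ pos i u' := by
    intro u u' h hu
    have hu' : seen ∅ u' k = Finset.univ := by rw [← seen_congr h, hu]
    have h1 : pos i u' < k := pos_lt_of_seen i hu'
    have h2 : (i : ℕ) < (seen ∅ u' (pos i u' + 1)).card :=
      lt_card_of_pos_lt (m := k) (by simp [hu']) (Nat.lt_succ_self _)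
    rw [← seen_congr (v := u) fun j hj => h j (by omega)] at h2
    exact Nat.lt_succ_iff.1 (pos_lt_of_lt_card h2)
  exact le_antisymm (key h hv) (key (fun j hj => (h j hj).symm) hw)

/-- Inserting `x` at position `q` creates the first occurrence of the `i`-th distinct letter iff
`x` is new and exactly `i` distinct letters precede it. -/
lemma pos_ins_eq_iff {w : ℕ → Fin n} (hw : ∀ x, ∃ k, w k = x) (i : Fin n) (q : ℕ) (x : Fin n) :
    pos i (ins q x w) = q ↔ x ∉ seen ∅ w q ∧ (seen ∅ w q).card = i := by
  have hw' : ∀ y, ∃ k, ins q x w k = y := by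
    intro y
    obtain ⟨k, rfl⟩ := hw y
    by_cases h : k < q
    · exact ⟨k, by simp [ins, h]⟩
    · exact ⟨k + 1, by simp [ins, show ¬ k + 1 < q by omega, show k + 1 ≠ q by omega]⟩
  have h1 : seen ∅ (ins q x w) q = seen ∅ w q := seen_congr fun j hj => by simp [ins, hj]
  have h2 : seen ∅ (ins q x w) (q + 1) = insert x (seen ∅ w q) := by
    rw [seen_succ, h1]; simp [ins]
  have e : pos i (ins q x w) = q ↔ q ≤ pos i (ins q x w) ∧ ¬ q + 1 ≤ pos i (ins q x w) := by omega
  rw [e, le_pos_iff hw', le_pos_iff hw', h1, h2]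
  by_cases hx : x ∈ seen ∅ w q
  · simp [hx]
  · rw [Finset.card_insert_of_notMem hx]
    simp only [hx, not_false_eq_true, true_and]
    omega

lemma exists_delPos_eq {w : ℕ → Fin n} (hw : ∀ x k, ∃ j, k ≤ j ∧ w j = x) (i : ℕ) :
    ∀ x k, ∃ j, k ≤ j ∧ delPos i w j = x := by
  intro x k
  obtain ⟨j, hj, rfl⟩ := hw x (k + pos i w + 1)
  refine ⟨j - 1, by omega, ?_⟩
  simp [delPos, del, show ¬ j - 1 < pos i w by omega, show j - 1 + 1 = j by omega]

/-- If all letters occur among the first `k` letters after the deletion, then before the deletion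
all letters occur among the first `k + 1`. -/
lemma seen_succ_of_seen_delPos {w : ℕ → Fin n} {k : ℕ} (i : Fin n)
    (h : seen ∅ (delPos i w) k = Finset.univ) :
    seen ∅ w (k + 1) = Finset.univ := by
  refine Finset.eq_univ_of_forall fun x => ?_
  have hx : x ∈ seen ∅ (delPos i w) k := h ▸ Finset.mem_univ x
  obtain ⟨j, hj, e⟩ := (mem_seen.1 hx).resolve_left (by simp)
  unfold delPos del at e
  split_ifs at e
  · exact mem_seen.2 (.inr ⟨j, by omega, e⟩)
  · exact mem_seen.2 (.inr ⟨j + 1, by omega, e⟩)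

lemma pos_le_of_seen_delPos {w : ℕ → Fin n} {k : ℕ} (i : Fin n)
    (h : seen ∅ (delPos i w) k = Finset.univ) : pos i w ≤ k :=
  Nat.lt_succ_iff.1 (pos_lt_of_seen i (seen_succ_of_seen_delPos i h))

lemma drop_delPos {w : ℕ → Fin n} {k i : ℕ} (h : pos i w ≤ k) :
    drop k (delPos i w) = drop (k + 1) w := by
  funext j
  simp [drop, delPos, del, show ¬ k + j < pos i w by omega, show k + j + 1 = k + 1 + j by omega]

lemma delPos_congr {v w : ℕ → Fin n} {k : ℕ} (i : Fin n) (h : ∀ j < k + 1, v j = w j)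
    (hv : seen ∅ v (k + 1) = Finset.univ) : ∀ j < k, delPos i v j = delPos i w j := by
  intro j hj
  have e := pos_congr i h hv
  unfold delPos del
  rw [← e, h j (by omega), h (j + 1) (by omega)]

/-! ### The density of the stationary distribution -/

/-- `σ_{≤ a}` as an extended nonnegative number. -/
noncomputable def cumE (σ : PMF (Fin n)) (a : ℕ) : ℝ≥0∞ := ∑ j : Fin n with j.val < a, σ j

/-- The weight contributed by the first `k` letters of `w`, where the letters in `A` count as
having occurred before: each letter that is not new contributes the factor `1 / σ_{≤ a}`, where `a`
is the number of distinct letters that have occurred so far. -/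
noncomputable def weightUpTo (σ : PMF (Fin n)) : ℕ → Finset (Fin n) → (ℕ → Fin n) → ℝ≥0∞
  | 0, _, _ => 1
  | k + 1, A, w =>
    if w 0 ∈ A then (cumE σ A.card)⁻¹ * weightUpTo σ k A (drop 1 w)
    else weightUpTo σ k (insert (w 0) A) (drop 1 w)

/-- The weight contributed by all letters of `w`.  Once all letters have occurred, the factors
are `1`, so this is a finite product for almost all words. -/
noncomputable def weight (σ : PMF (Fin n)) (A : Finset (Fin n)) (w : ℕ → Fin n) : ℝ≥0∞ :=
  ⨆ k, weightUpTo σ k A w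

lemma cumE_zero (σ : PMF (Fin n)) : cumE σ 0 = 0 := by simp [cumE]

lemma cumE_succ (σ : PMF (Fin n)) (i : Fin n) : cumE σ (i + 1) = cumE σ i + σ i := by
  have : (Finset.univ.filter fun j : Fin n => j.val < i + 1)
      = insert i (Finset.univ.filter fun j : Fin n => j.val < i) := by
    ext j
    simp only [Finset.mem_filter, Finset.mem_univ, true_and, Finset.mem_insert, Fin.ext_iff]
    omega
  rw [cumE, this, Finset.sum_insert (by simp), add_comm, cumE]

lemma cumE_self (σ : PMF (Fin n)) : cumE σ n = 1 := by
  rw [cumE, Finset.filter_true_of_mem (by simp), ← σ.tsum_coe, tsum_fintype]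

lemma cumE_le_one (σ : PMF (Fin n)) (a : ℕ) : cumE σ a ≤ 1 := by
  rw [← cumE_self σ, cumE, cumE]
  exact Finset.sum_le_sum_of_subset (fun j _ => by simp)

lemma cumE_ne_top (σ : PMF (Fin n)) (a : ℕ) : cumE σ a ≠ ∞ :=
  ((cumE_le_one σ a).trans_lt ENNReal.one_lt_top).ne

lemma toReal_cumE (σ : PMF (Fin n)) (a : ℕ) : (cumE σ a).toReal = cum σ a := by
  rw [cumE, cum, ENNReal.toReal_sum fun j _ => σ.apply_ne_top j]

/-- The condition on `σ` in multiplicative form. -/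
lemma Star.lt_mul_cum {σ : PMF (Fin n)} (hσ : Star σ) {a : ℕ} (h1 : 1 ≤ a) (h2 : a < n) :
    (a : ℝ) < n * cum σ a := by
  have h := hσ a h1 (by omega)
  have hn : (0 : ℝ) < n := by exact_mod_cast (by omega : 0 < n)
  rwa [div_lt_iff₀' hn] at h

lemma Star.apply_zero_ne_zero [NeZero n] {σ : PMF (Fin n)} (hσ : Star σ) : σ 0 ≠ 0 := by
  intro h0
  have e : cumE σ 1 = 0 := by
    have := cumE_succ σ 0
    simpa [cumE_zero, h0] using this
  rcases (NeZero.one_le (n := n)).lt_or_eq with h | h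
  · have h1 := hσ.lt_mul_cum le_rfl h
    rw [← toReal_cumE, e] at h1
    norm_num at h1
  · have e1 : cumE σ 1 = 1 := (congrArg (cumE σ) h).trans (cumE_self σ)
    exact zero_ne_one (e.symm.trans e1)

lemma Star.cumE_ne_zero [NeZero n] {σ : PMF (Fin n)} (hσ : Star σ) {a : ℕ} (h : a ≠ 0) :
    cumE σ a ≠ 0 := fun h0 =>
  hσ.apply_zero_ne_zero (Finset.sum_eq_zero_iff.1 h0 0 (by simp; omega))

lemma weightUpTo_succ_cons (σ : PMF (Fin n)) (k : ℕ) (A : Finset (Fin n)) (x : Fin n)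
    (w : ℕ → Fin n) :
    weightUpTo σ (k + 1) A (cons x w) =
      if x ∈ A then (cumE σ A.card)⁻¹ * weightUpTo σ k A w
      else weightUpTo σ k (insert x A) w := by
  simp [weightUpTo]

lemma weightUpTo_le_succ (σ : PMF (Fin n)) (k : ℕ) (A : Finset (Fin n)) (w : ℕ → Fin n) :
    weightUpTo σ k A w ≤ weightUpTo σ (k + 1) A w := by
  induction k generalizing A w with
  | zero =>
    simp only [weightUpTo]
    split_ifs
    · simp [cumE_le_one]
    · exact le_rfl
  | succ k ih =>
    rw [← cons_drop_one w, weightUpTo_succ_cons, weightUpTo_succ_cons]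
    split_ifs
    · gcongr
      exact ih _ _
    · exact ih _ _

lemma weightUpTo_mono (σ : PMF (Fin n)) (A : Finset (Fin n)) (w : ℕ → Fin n) :
    Monotone fun k => weightUpTo σ k A w :=
  monotone_nat_of_le_succ fun k => weightUpTo_le_succ σ k A w

lemma one_le_weight (σ : PMF (Fin n)) (A : Finset (Fin n)) (w : ℕ → Fin n) : 1 ≤ weight σ A w :=
  le_iSup (fun k => weightUpTo σ k A w) 0

lemma weight_cons (σ : PMF (Fin n)) (A : Finset (Fin n)) (x : Fin n) (w : ℕ → Fin n) :
    weight σ A (cons x w) =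
      if x ∈ A then (cumE σ A.card)⁻¹ * weight σ A w else weight σ (insert x A) w := by
  rw [weight, ← (weightUpTo_mono σ A (cons x w)).iSup_nat_add 1]
  simp only [weightUpTo_succ_cons]
  split_ifs
  · rw [weight, ENNReal.mul_iSup]
  · rfl

lemma weight_univ (σ : PMF (Fin n)) (w : ℕ → Fin n) : weight σ Finset.univ w = 1 := by
  have h : ∀ k w, weightUpTo σ k Finset.univ w = 1 := by
    intro k
    induction k with
    | zero => intro w; rfl
    | succ k ih => intro w; simp [weightUpTo, ih, cumE_self]
  simp [weight, h]

/-- The weight of a word only depends on its letters up to the time all letters have occurred. -/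
lemma weight_congr (σ : PMF (Fin n)) {A : Finset (Fin n)} {v w : ℕ → Fin n} {k : ℕ}
    (h : ∀ j < k, v j = w j) (hv : seen A v k = Finset.univ) : weight σ A v = weight σ A w := by
  induction k generalizing A v w with
  | zero =>
    rw [seen_zero] at hv
    rw [hv, weight_univ, weight_univ]
  | succ k ih =>
    have h0 : v 0 = w 0 := h 0 (by omega)
    rw [← cons_drop_one v, seen_cons_succ] at hv
    have hd : ∀ j < k, drop 1 v j = drop 1 w j := fun j hj => h (1 + j) (by omega)
    rw [← cons_drop_one v, ← cons_drop_one w, weight_cons, weight_cons, h0]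
    rw [h0] at hv
    split_ifs with hA
    · rw [Finset.insert_eq_of_mem hA] at hv
      rw [ih hd hv]
    · rw [ih hd hv]

/-- The probability that `σ` assigns to the `i`-th index, extended by zero. -/
noncomputable def probAt (σ : PMF (Fin n)) (i : ℕ) : ℝ≥0∞ := if h : i < n then σ ⟨i, h⟩ else 0

lemma cumE_add_probAt (σ : PMF (Fin n)) {A : Finset (Fin n)} {x : Fin n} (h : x ∉ A) :
    cumE σ A.card + probAt σ A.card = cumE σ (insert x A).card := by
  have hc : A.card < n := by
    have := Finset.card_le_univ (insert x A)
    rw [Finset.card_insert_of_notMem h, Fintype.card_fin] at this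
    omega
  rw [Finset.card_insert_of_notMem h, probAt, dif_pos hc]
  exact (cumE_succ σ ⟨_, hc⟩).symm

lemma tsum_ins_cons (σ : PMF (Fin n)) (A : Finset (Fin n)) (x y : Fin n) (w : ℕ → Fin n) :
    ∑' q, (if x ∉ seen A (cons y w) q then
        probAt σ (seen A (cons y w) q).card * weight σ A (ins q x (cons y w)) else 0) =
      (if x ∉ A then probAt σ A.card * weight σ A (cons x (cons y w)) else 0) +
      ∑' q, (if x ∉ seen (insert y A) w q then
        probAt σ (seen (insert y A) w q).card * weight σ A (cons y (ins q x w)) else 0) := by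
  rw [tsum_eq_zero_add' ENNReal.summable, seen_zero, ins_zero]
  simp only [ins_succ_cons, seen_cons_succ]

lemma tsum_ins_add_of_head [NeZero n] {σ : PMF (Fin n)} (hσ : Star σ) {A : Finset (Fin n)}
    {x : Fin n} (hA : x ∉ A) (w : ℕ → Fin n) :
    ∑' q, (if x ∉ seen A (cons x w) q then
        probAt σ (seen A (cons x w) q).card * weight σ A (ins q x (cons x w)) else 0) +
      cumE σ A.card * weight σ (insert x A) (cons x w) = weight σ A (cons x w) := by
  have h0 : ∀ q, x ∈ seen (insert x A) w q := fun q =>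
    mem_seen.2 (.inl (Finset.mem_insert_self _ _))
  have hc : cumE σ (insert x A).card ≠ 0 :=
    hσ.cumE_ne_zero (Finset.card_pos.2 ⟨x, Finset.mem_insert_self _ _⟩).ne'
  rw [tsum_ins_cons]
  simp only [h0, hA, not_false_eq_true, not_true_eq_false, if_true, if_false, tsum_zero, add_zero]
  rw [weight_cons, if_neg hA, ← add_mul, add_comm, cumE_add_probAt σ hA, weight_cons,
    if_pos (Finset.mem_insert_self _ _), ← mul_assoc, ENNReal.mul_inv_cancel hc (cumE_ne_top _ _),
    one_mul, weight_cons, if_neg hA]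

/-- The weighted sum over all words that arise from `w` by inserting a new letter `x` before its
first occurrence telescopes. -/
lemma tsum_ins_add [NeZero n] {σ : PMF (Fin n)} (hσ : Star σ) {A : Finset (Fin n)} {x : Fin n}
    (hA : x ∉ A) (w : ℕ → Fin n) (hw : ∃ k, w k = x) :
    ∑' q, (if x ∉ seen A w q then probAt σ (seen A w q).card * weight σ A (ins q x w) else 0) +
      cumE σ A.card * weight σ (insert x A) w = weight σ A w := by
  obtain ⟨k, hk⟩ := hw
  induction k generalizing A w with
  | zero =>
    rw [← cons_drop_one w, hk]
    exact tsum_ins_add_of_head hσ hA _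
  | succ k ih =>
    obtain ⟨y, v, rfl⟩ : ∃ y v, w = cons y v := ⟨_, _, (cons_drop_one w).symm⟩
    by_cases hx : y = x
    · rw [hx]
      exact tsum_ins_add_of_head hσ hA _
    rw [cons_succ] at hk
    rw [tsum_ins_cons, if_pos hA]
    by_cases hy : y ∈ A
    · have hc : cumE σ A.card ≠ 0 := hσ.cumE_ne_zero (Finset.card_pos.2 ⟨y, hy⟩).ne'
      have hc' : cumE σ (insert x A).card ≠ 0 :=
        hσ.cumE_ne_zero (Finset.card_pos.2 ⟨x, Finset.mem_insert_self _ _⟩).ne'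
      have hyx : y ∈ insert x A := Finset.mem_insert_of_mem hy
      simp only [weight_cons, if_neg hA, if_pos hy, if_pos hyx, Finset.insert_eq_of_mem hy]
      have e : ∑' q, (if x ∉ seen A v q then
          probAt σ (seen A v q).card * ((cumE σ A.card)⁻¹ * weight σ A (ins q x v)) else 0) =
          (cumE σ A.card)⁻¹ * ∑' q, (if x ∉ seen A v q then
          probAt σ (seen A v q).card * weight σ A (ins q x v) else 0) := by
        rw [← ENNReal.tsum_mul_left]
        refine tsum_congr fun q => ?_
        split_ifs
        · simp
        · rw [mul_left_comm]
      set T := ∑' q, (if x ∉ seen A v q then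
          probAt σ (seen A v q).card * weight σ A (ins q x v) else 0) with hT
      set u := weight σ (insert x A) v
      rw [e]
      calc _ = (cumE σ A.card + probAt σ A.card) * ((cumE σ (insert x A).card)⁻¹ * u) +
            (cumE σ A.card)⁻¹ * T := by ring
        _ = u + (cumE σ A.card)⁻¹ * T := by
            rw [cumE_add_probAt σ hA, ← mul_assoc, ENNReal.mul_inv_cancel hc' (cumE_ne_top _ _),
              one_mul]
        _ = (cumE σ A.card)⁻¹ * (T + cumE σ A.card * u) := by
            rw [mul_add, ← mul_assoc _ _ u, ENNReal.inv_mul_cancel hc (cumE_ne_top _ _), one_mul,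
              add_comm]
        _ = _ := by rw [ih hA v hk]
    · have hA' : x ∉ insert y A := by simp [hA, Ne.symm hx]
      have hyx : y ∉ insert x A := by simp [hy, hx]
      simp only [weight_cons, if_neg hA, if_neg hy, if_neg hyx]
      rw [← ih hA' v hk, Finset.insert_comm, ← cumE_add_probAt σ hy]
      ring

/-! ### Independent uniform letters -/

/-- The law of a word with independent uniform letters. -/
noncomputable def iid (n : ℕ) : Measure (ℕ → Fin n) :=
  Measure.infinitePi fun _ => uniformOn (Set.univ : Set (Fin n))

instance [NeZero n] : IsProbabilityMeasure (uniformOn (Set.univ : Set (Fin n))) :=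
  isProbabilityMeasure_uniformOn Set.finite_univ Set.univ_nonempty

instance [NeZero n] : IsProbabilityMeasure (iid n) := by
  unfold iid; infer_instance

lemma measurable_cons : Measurable fun p : Fin n × (ℕ → Fin n) => cons p.1 p.2 := by
  refine measurable_pi_iff.2 fun k => ?_
  cases k with
  | zero => exact measurable_fst
  | succ k => exact (measurable_pi_apply k).comp measurable_snd

@[fun_prop]
lemma measurable_cons_right (x : Fin n) : Measurable (cons x) :=
  measurable_cons.comp measurable_prodMk_left

@[fun_prop]
lemma measurable_drop (k : ℕ) : Measurable (drop k : (ℕ → Fin n) → ℕ → Fin n) :=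
  measurable_pi_iff.2 fun j => measurable_pi_apply (k + j)

@[fun_prop]
lemma measurable_ins (q : ℕ) (x : Fin n) : Measurable (ins q x) := by
  refine measurable_pi_iff.2 fun k => ?_
  unfold ins
  split_ifs
  · exact measurable_pi_apply k
  · exact measurable_const
  · exact measurable_pi_apply _

@[fun_prop]
lemma measurable_del (q : ℕ) : Measurable (del q : (ℕ → Fin n) → ℕ → Fin n) := by
  refine measurable_pi_iff.2 fun k => ?_
  unfold del
  split_ifs <;> exact measurable_pi_apply _

lemma map_cons_prod_iid [NeZero n] :
    ((uniformOn (Set.univ : Set (Fin n))).prod (iid n)).map (fun p => cons p.1 p.2) = iid n := by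
  refine Measure.eq_infinitePi _ fun s t ht => ?_
  classical
  obtain ⟨m, hm⟩ : ∃ m, s ⊆ Finset.range (m + 1) :=
    ⟨s.sup id, fun i hi => Finset.mem_range.2 (Nat.lt_succ_of_le (Finset.le_sup (f := id) hi))⟩
  set t' : ℕ → Set (Fin n) := fun i => if i ∈ s then t i else Set.univ with ht'
  have e1 : Set.pi (s : Set ℕ) t = Set.pi (Finset.range (m + 1) : Set ℕ) t' := by
    ext w
    simp only [Set.mem_pi, Finset.mem_coe, ht']
    constructor
    · intro h i _
      split_ifs with hi
      · exact h i hi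
      · trivial
    · intro h i hi
      simpa [hi] using h i (hm hi)
  have e2 : ∏ i ∈ s, uniformOn (Set.univ : Set (Fin n)) (t i) =
      ∏ i ∈ Finset.range (m + 1), uniformOn (Set.univ : Set (Fin n)) (t' i) := by
    rw [← Finset.prod_subset hm]
    · exact Finset.prod_congr rfl fun i hi => by simp [ht', hi]
    · intro i _ hi
      simp [ht', hi]
  have e3 : (fun p : Fin n × (ℕ → Fin n) => cons p.1 p.2) ⁻¹'
      Set.pi (Finset.range (m + 1) : Set ℕ) t' =
      t' 0 ×ˢ Set.pi (Finset.range m : Set ℕ) (fun i => t' (i + 1)) := by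
    ext ⟨x, w⟩
    simp only [Set.mem_preimage, Set.mem_pi, Finset.mem_coe, Finset.mem_range, Set.mem_prod]
    constructor
    · exact fun h => ⟨h 0 (by omega), fun i hi => h (i + 1) (by omega)⟩
    · rintro ⟨h0, h1⟩ i hi
      cases i with
      | zero => exact h0
      | succ i => exact h1 i (by omega)
  rw [e1, e2, Measure.map_apply measurable_cons, e3, Measure.prod_prod, iid,
    Measure.infinitePi_pi _ fun i _ => by measurability, Finset.prod_range_succ', mul_comm]
  exact MeasurableSet.pi (Finset.countable_toSet _) fun i _ => by measurability

/-- The average of a function over the letters. -/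
lemma lintegral_uniformOn (F : Fin n → ℝ≥0∞) :
    ∫⁻ x, F x ∂(uniformOn (Set.univ : Set (Fin n))) = (n : ℝ≥0∞)⁻¹ * ∑ x, F x := by
  rw [lintegral_fintype, Finset.mul_sum]
  refine Finset.sum_congr rfl fun x _ => ?_
  rw [uniformOn_univ]
  simp [mul_comm, div_eq_mul_inv]

/-- The first letter is uniform and independent of the remaining ones, which are again independent
and uniform. -/
lemma lintegral_iid [NeZero n] {F : (ℕ → Fin n) → ℝ≥0∞} (hF : Measurable F) :
    ∫⁻ w, F w ∂iid n = (n : ℝ≥0∞)⁻¹ * ∑ x, ∫⁻ w, F (cons x w) ∂iid n := by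
  have hF' : Measurable fun p : Fin n × (ℕ → Fin n) => F (cons p.1 p.2) := hF.comp measurable_cons
  conv_lhs => rw [← map_cons_prod_iid]
  rw [lintegral_map hF measurable_cons, lintegral_prod _ hF'.aemeasurable,
    lintegral_uniformOn]

/-- Inserting a uniform letter at a fixed position preserves the law. -/
lemma lintegral_ins [NeZero n] (q : ℕ) {F : (ℕ → Fin n) → ℝ≥0∞} (hF : Measurable F) :
    (n : ℝ≥0∞)⁻¹ * ∑ x, ∫⁻ w, F (ins q x w) ∂iid n = ∫⁻ w, F w ∂iid n := by
  induction q generalizing F with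
  | zero =>
    simp only [ins_zero]
    rw [lintegral_iid hF]
  | succ q ih =>
    have h : ∀ x, ∫⁻ w, F (ins (q + 1) x w) ∂iid n =
        (n : ℝ≥0∞)⁻¹ * ∑ y, ∫⁻ w, F (cons y (ins q x w)) ∂iid n := by
      intro x
      rw [lintegral_iid (by fun_prop)]
      simp only [ins_succ_cons]
    simp only [h]
    rw [lintegral_iid hF, ← Finset.mul_sum, Finset.sum_comm, Finset.mul_sum]
    congr 1
    refine Finset.sum_congr rfl fun y _ => ?_
    exact ih (hF.comp (measurable_cons_right y))

/-- A function of the first `k` letters is independent of the remaining word. -/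
lemma lintegral_mul_drop [NeZero n] (k : ℕ) {F H : (ℕ → Fin n) → ℝ≥0∞} (hF : Measurable F)
    (hFk : ∀ v w, (∀ j < k, v j = w j) → F v = F w) (hH : Measurable H) :
    ∫⁻ w, F w * H (drop k w) ∂iid n = (∫⁻ w, F w ∂iid n) * ∫⁻ w, H w ∂iid n := by
  induction k generalizing F with
  | zero =>
    have h : ∀ w, F w = F (fun _ => 0) := fun w => hFk _ _ (by simp)
    simp only [drop_zero]
    rw [lintegral_congr h, lintegral_const, measure_univ, mul_one, ← lintegral_const_mul _ hH]
    exact lintegral_congr fun w => by rw [h w]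
  | succ k ih =>
    rw [lintegral_iid (by fun_prop), lintegral_iid hF, mul_assoc,
      Finset.sum_mul]
    congr 1
    refine Finset.sum_congr rfl fun x _ => ?_
    simp only [drop_succ_cons]
    refine ih (F := fun w => F (cons x w)) (hF.comp (measurable_cons_right x)) fun v w h => ?_
    refine hFk _ _ fun j hj => ?_
    cases j with
    | zero => rfl
    | succ j => exact h j (by omega)

lemma map_drop_iid [NeZero n] (k : ℕ) : (iid n).map (drop k) = iid n := by
  ext C hC
  rw [Measure.map_apply (measurable_drop k) hC]
  have h := lintegral_mul_drop (n := n) k (F := fun _ => 1) (H := C.indicator 1) measurable_const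
    (fun _ _ _ => rfl) (measurable_one.indicator hC)
  simp only [one_mul, lintegral_one, measure_univ] at h
  rw [lintegral_indicator_one hC] at h
  rw [← h, ← lintegral_indicator_one (measurable_drop k hC)]
  rfl

/-- Almost surely every letter occurs. -/
lemma ae_exists_eq [NeZero n] : ∀ᵐ w ∂iid n, ∀ x, ∃ k, w k = x := by
  refine ae_all_iff.2 fun x => ?_
  set N : Set (ℕ → Fin n) := {w | ∀ k, w k ≠ x} with hN
  have hm : MeasurableSet N := by
    have : N = ⋂ k, (fun w => w k) ⁻¹' {x}ᶜ := by ext w; simp [hN]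
    rw [this]
    exact MeasurableSet.iInter fun k => measurable_pi_apply k (Set.toFinite _).measurableSet
  -- conditioning on the first letter gives `n * P(N) = (n - 1) * P(N)`
  have h := lintegral_iid (n := n) (F := N.indicator 1) (measurable_one.indicator hm)
  have hc : ∀ y, ∫⁻ w, N.indicator (1 : (ℕ → Fin n) → ℝ≥0∞) (cons y w) ∂iid n =
      if y = x then 0 else iid n N := by
    intro y
    rw [← lintegral_indicator_one hm]
    split_ifs with hy
    · refine (lintegral_congr fun w => ?_).trans lintegral_zero
      exact Set.indicator_of_notMem (fun hw : cons y w ∈ N => hw 0 hy) _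
    · refine lintegral_congr fun w => ?_
      have : cons y w ∈ N ↔ w ∈ N :=
        ⟨fun hw k => hw (k + 1), fun hw k => by
          cases k with
          | zero => exact hy
          | succ k => exact hw k⟩
      by_cases hw : w ∈ N <;> simp [hw, this]
  have hn : (n : ℝ≥0∞) ≠ 0 := by simp [NeZero.ne n]
  have hp : iid n N ≠ ∞ := measure_ne_top _ _
  simp only [hc] at h
  rw [lintegral_indicator_one hm] at h
  have h2 : ∑ y : Fin n, iid n N = ∑ y, if y = x then 0 else iid n N := by
    rw [Finset.sum_const, Finset.card_univ, Fintype.card_fin, nsmul_eq_mul]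
    conv_lhs => rw [h]
    rw [← mul_assoc, ENNReal.mul_inv_cancel hn (by simp), one_mul]
  rw [← Finset.add_sum_erase _ _ (Finset.mem_univ x),
    ← Finset.add_sum_erase _ (fun y => if y = x then 0 else iid n N) (Finset.mem_univ x)] at h2
  have h3 : ∑ y ∈ Finset.univ.erase x, (if y = x then 0 else iid n N) =
      ∑ y ∈ Finset.univ.erase x, iid n N :=
    Finset.sum_congr rfl fun y hy => if_neg (Finset.ne_of_mem_erase hy)
  rw [h3, if_pos rfl] at h2
  have h4 : iid n N = 0 :=
    (ENNReal.add_left_inj (ENNReal.sum_ne_top.2 fun _ _ => hp)).1 h2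
  have e : {w : ℕ → Fin n | ¬ ∃ k, w k = x} = N := by ext w; simp [hN]
  rw [ae_iff, e, h4]

/-- Almost surely every letter occurs infinitely often. -/
lemma ae_exists_le_eq [NeZero n] : ∀ᵐ w ∂iid n, ∀ x k, ∃ j, k ≤ j ∧ w j = x := by
  have h : ∀ᵐ w ∂iid n, ∀ k, ∀ x, ∃ j, drop k w j = x := by
    refine ae_all_iff.2 fun k => ?_
    have := ae_exists_eq (n := n)
    rw [← map_drop_iid k] at this
    exact ae_of_ae_map (measurable_drop k).aemeasurable this
  filter_upwards [h] with w hw x k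
  obtain ⟨j, hj⟩ := hw k x
  exact ⟨k + j, by omega, hj⟩

/-! ### Measurability -/

/-- There are only finitely many prefixes of length `k`, so measurability is automatic for functions
of the first `k` letters. -/
lemma measurable_of_prefix [NeZero n] {β : Type*} [MeasurableSpace β] (k : ℕ)
    {F : (ℕ → Fin n) → β} (hF : ∀ v w, (∀ j < k, v j = w j) → F v = F w) : Measurable F := by
  have e : F = (fun u : Fin k → Fin n => F fun j => if h : j < k then u ⟨j, h⟩ else 0) ∘
      fun w j => w j := by
    funext w
    exact hF _ _ fun j hj => by simp [hj]
  rw [e]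
  exact Measurable.of_discrete.comp (measurable_pi_iff.2 fun j => measurable_pi_apply _)

lemma measurableSet_of_prefix [NeZero n] (k : ℕ) {p : (ℕ → Fin n) → Prop}
    (hp : ∀ v w, (∀ j < k, v j = w j) → (p v ↔ p w)) : MeasurableSet {w | p w} :=
  measurableSet_setOfPred.2 (measurable_of_prefix k fun v w h => propext (hp v w h))

lemma measurableSet_seen [NeZero n] (k : ℕ) (A : Finset (Fin n)) (p : Finset (Fin n) → Prop) :
    MeasurableSet {w : ℕ → Fin n | p (seen A w k)} :=
  measurableSet_of_prefix k fun v w h => by rw [seen_congr h]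

@[fun_prop]
lemma measurable_pos [NeZero n] (i : ℕ) : Measurable (pos i : (ℕ → Fin n) → ℕ) := by
  refine measurable_of_Iic fun m => ?_
  have e : pos i ⁻¹' Set.Iic m =
      (⋃ q ∈ Set.Iic m, {w : ℕ → Fin n | i < (seen ∅ w (q + 1)).card}) ∪
      (⋂ q, {w : ℕ → Fin n | ¬ i < (seen ∅ w (q + 1)).card}) := by
    ext w
    simp only [Set.mem_preimage, Set.mem_Iic, Set.mem_union, Set.mem_iUnion, Set.mem_iInter,
      Set.mem_ofPred_eq, exists_prop]
    constructor
    · intro h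
      by_cases hq : ∃ q, i < (seen ∅ w (q + 1)).card
      · exact .inl ⟨pos i w, h, Nat.sInf_mem (s := {q | i < (seen ∅ w (q + 1)).card}) hq⟩
      · exact .inr (not_exists.1 hq)
    · rintro (⟨q, hq, h⟩ | h)
      · exact le_trans (Nat.sInf_le (s := {q | i < (seen ∅ w (q + 1)).card}) h) hq
      · have : pos i w = 0 := by simp [pos, h]
        omega
  rw [e]
  exact (MeasurableSet.biUnion (Set.to_countable _) fun q _ =>
    measurableSet_seen (q + 1) ∅ fun s => i < s.card).union
    (MeasurableSet.iInter fun q => measurableSet_seen (q + 1) ∅ fun s => ¬ i < s.card)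

@[fun_prop]
lemma measurable_delPos [NeZero n] (i : ℕ) :
    Measurable (delPos i : (ℕ → Fin n) → ℕ → Fin n) := by
  refine measurable_pi_iff.2 fun k => ?_
  exact Measurable.ite (measurable_pos i measurableSet_Ioi) (measurable_pi_apply k)
    (measurable_pi_apply (k + 1))

lemma weightUpTo_congr (σ : PMF (Fin n)) {A : Finset (Fin n)} {v w : ℕ → Fin n} {k : ℕ}
    (h : ∀ j < k, v j = w j) : weightUpTo σ k A v = weightUpTo σ k A w := by
  induction k generalizing A v w with
  | zero => rfl
  | succ k ih =>
    have h0 : v 0 = w 0 := h 0 (by omega)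
    have hd : ∀ j < k, drop 1 v j = drop 1 w j := fun j hj => h (1 + j) (by omega)
    simp only [weightUpTo, h0, ih hd]

@[fun_prop]
lemma measurable_weightUpTo [NeZero n] (σ : PMF (Fin n)) (k : ℕ) (A : Finset (Fin n)) :
    Measurable (weightUpTo σ k A) :=
  measurable_of_prefix k fun _ _ h => weightUpTo_congr σ h

@[fun_prop]
lemma measurable_weight [NeZero n] (σ : PMF (Fin n)) (A : Finset (Fin n)) :
    Measurable (weight σ A) :=
  Measurable.iSup fun k => measurable_weightUpTo σ k A

/-! ### The transition operator and its stationary measure -/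

/-- The law of the word after one deletion, if `m` is the law of the word before. -/
noncomputable def step (σ : PMF (Fin n)) (m : Measure (ℕ → Fin n)) : Measure (ℕ → Fin n) :=
  ∑ i, σ i • m.map (delPos i)

lemma lintegral_step [NeZero n] (σ : PMF (Fin n)) (m : Measure (ℕ → Fin n))
    {F : (ℕ → Fin n) → ℝ≥0∞} (hF : Measurable F) :
    ∫⁻ w, F w ∂step σ m = ∑ i, σ i * ∫⁻ w, F (delPos i w) ∂m := by
  rw [step, lintegral_finsetSum_measure]
  refine Finset.sum_congr rfl fun i _ => ?_
  rw [lintegral_smul_measure, lintegral_map hF (measurable_delPos i), smul_eq_mul]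

lemma step_add [NeZero n] (σ : PMF (Fin n)) (m m' : Measure (ℕ → Fin n)) :
    step σ (m + m') = step σ m + step σ m' := by
  simp only [step, Measure.map_add _ _ (measurable_delPos _), smul_add, Finset.sum_add_distrib]

lemma step_smul [NeZero n] (σ : PMF (Fin n)) (c : ℝ≥0∞) (m : Measure (ℕ → Fin n)) :
    step σ (c • m) = c • step σ m := by
  simp only [step, Measure.map_smul, Finset.smul_sum, smul_comm c]

lemma step_univ [NeZero n] (σ : PMF (Fin n)) (m : Measure (ℕ → Fin n)) :
    step σ m Set.univ = m Set.univ := by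
  have h := lintegral_step σ m (F := fun _ => 1) measurable_const
  simp only [lintegral_one, ← Finset.sum_mul] at h
  rw [h, ← tsum_fintype (L := SummationFilter.unconditional _), σ.tsum_coe, one_mul]

/-- The measure with density `weight` is stationary. -/
lemma step_withDensity_weight [NeZero n] {σ : PMF (Fin n)} (hσ : Star σ) :
    step σ ((iid n).withDensity (weight σ ∅)) = (iid n).withDensity (weight σ ∅) := by
  refine Measure.ext_of_lintegral _ fun F hF => ?_
  have hW := measurable_weight σ (∅ : Finset (Fin n))
  have hn : (n : ℝ≥0∞) ≠ 0 := by simp [NeZero.ne n]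
  rw [lintegral_step σ _ hF, lintegral_withDensity_eq_lintegral_mul _ hW hF]
  -- split according to the position of the deleted letter and average over that letter
  have h1 : ∀ i : Fin n, ∫⁻ w, F (delPos i w) ∂(iid n).withDensity (weight σ ∅) =
      ∑' q, (n : ℝ≥0∞)⁻¹ * ∑ x, ∫⁻ w, (if x ∉ seen ∅ w q ∧ (seen ∅ w q).card = i then
        weight σ ∅ (ins q x w) * F w else 0) ∂iid n := by
    intro i
    rw [lintegral_withDensity_eq_lintegral_mul _ hW (by fun_prop)]
    have hm : ∀ q, Measurable fun w =>
        if pos i w = q then weight σ ∅ w * F (del q w) else 0 := fun q =>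
      Measurable.ite (measurable_pos i (measurableSet_singleton q)) (by fun_prop) measurable_const
    have h2 : ∀ w, (weight σ ∅ * fun w => F (delPos i w)) w =
        ∑' q, if pos i w = q then weight σ ∅ w * F (del q w) else 0 := by
      intro w
      rw [tsum_eq_single (pos i w) fun q hq => if_neg (Ne.symm hq), if_pos rfl]
      rfl
    rw [lintegral_congr h2, lintegral_tsum fun q => (hm q).aemeasurable]
    refine tsum_congr fun q => ?_
    rw [← lintegral_ins q (hm q)]
    congr 1
    refine Finset.sum_congr rfl fun x _ => lintegral_congr_ae ?_
    filter_upwards [ae_exists_eq (n := n)] with w hw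
    simp only [pos_ins_eq_iff hw, del_ins]
  have hms : ∀ (x : Fin n) (q : ℕ), MeasurableSet {w : ℕ → Fin n | x ∉ seen ∅ w q} := fun x q =>
    measurableSet_seen q ∅ fun s => x ∉ s
  have hmp : ∀ q, Measurable fun w : ℕ → Fin n => probAt σ (seen ∅ w q).card := fun q =>
    measurable_of_prefix q fun v w h => by rw [seen_congr h]
  have h3 : ∀ (i x : Fin n) q, Measurable fun w => (if x ∉ seen ∅ w q ∧ (seen ∅ w q).card = i then
        weight σ ∅ (ins q x w) * F w else 0) := fun i x q =>
    Measurable.ite (measurableSet_seen q ∅ fun s => x ∉ s ∧ s.card = i) (by fun_prop)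
      measurable_const
  calc ∑ i, σ i * ∫⁻ w, F (delPos i w) ∂(iid n).withDensity (weight σ ∅)
      = (n : ℝ≥0∞)⁻¹ * ∑ x : Fin n, ∑' q, ∫⁻ w, ∑ i : Fin n, σ i *
          (if x ∉ seen ∅ w q ∧ (seen ∅ w q).card = i then
            weight σ ∅ (ins q x w) * F w else 0) ∂iid n := by
        have h5 : ∀ (x : Fin n) q, ∫⁻ w, ∑ i : Fin n, σ i *
            (if x ∉ seen ∅ w q ∧ (seen ∅ w q).card = i then
              weight σ ∅ (ins q x w) * F w else 0) ∂iid n =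
            ∑ i : Fin n, σ i * ∫⁻ w, (if x ∉ seen ∅ w q ∧ (seen ∅ w q).card = i then
              weight σ ∅ (ins q x w) * F w else 0) ∂iid n := by
          intro x q
          rw [lintegral_finsetSum _ fun i _ => (h3 i x q).const_mul _]
          exact Finset.sum_congr rfl fun i _ => lintegral_const_mul _ (h3 i x q)
        simp only [h1, h5, ENNReal.tsum_mul_left,
          Summable.tsum_finsetSum fun _ _ => ENNReal.summable]
        rw [Finset.sum_comm, Finset.mul_sum]
        refine Finset.sum_congr rfl fun i _ => ?_
        rw [mul_left_comm, Finset.mul_sum]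
    _ = (n : ℝ≥0∞)⁻¹ * ∑ x : Fin n, ∫⁻ w, weight σ ∅ w * F w ∂iid n := by
        congr 1
        refine Finset.sum_congr rfl fun x _ => ?_
        rw [← lintegral_tsum fun q => (Finset.measurable_sum _ fun i _ =>
          (h3 i x q).const_mul _).aemeasurable]
        refine lintegral_congr_ae ?_
        filter_upwards [ae_exists_eq (n := n)] with w hw
        have h4 := tsum_ins_add hσ (Finset.notMem_empty x) w (hw x)
        rw [Finset.card_empty, cumE_zero, zero_mul, add_zero] at h4
        conv_rhs => rw [← h4]
        rw [← ENNReal.tsum_mul_right]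
        refine tsum_congr fun q => ?_
        by_cases hx : x ∈ seen ∅ w q
        · simp [hx]
        · have hc : (seen ∅ w q).card < n := by
            have := Finset.card_lt_univ_of_notMem hx
            simpa using this
          simp only [hx, not_false_eq_true, true_and, if_true, probAt, dif_pos hc]
          rw [Finset.sum_eq_single ⟨_, hc⟩]
          · simp [mul_assoc]
          · intro i _ hi
            rw [if_neg, mul_zero]
            intro h
            exact hi (Fin.ext h.symm)
          · simp
    _ = _ := by
        rw [Finset.sum_const, Finset.card_univ, Fintype.card_fin, nsmul_eq_mul, ← mul_assoc,
          ENNReal.inv_mul_cancel hn (by simp), one_mul]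
        rfl

/-! ### Normalization and the law of the positions -/

/-- The probability `a / (n σ_{≤ a})` that, under the stationary distribution, a letter is not new
if `a` distinct letters precede it. -/
noncomputable def oldProb (σ : PMF (Fin n)) (a : ℕ) : ℝ≥0∞ := (n : ℝ≥0∞)⁻¹ * a * (cumE σ a)⁻¹

lemma oldProb_zero (σ : PMF (Fin n)) : oldProb σ 0 = 0 := by simp [oldProb]

lemma oldProb_eq_ofReal [NeZero n] {σ : PMF (Fin n)} (hσ : Star σ) {a : ℕ} (ha : a ≠ 0) :
    oldProb σ a = ENNReal.ofReal (a / (n * cum σ a)) := by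
  have hn : (0 : ℝ) < n := by exact_mod_cast Nat.pos_of_ne_zero (NeZero.ne n)
  have hc : 0 < cum σ a := by
    rw [← toReal_cumE]
    exact ENNReal.toReal_pos (hσ.cumE_ne_zero ha) (cumE_ne_top _ _)
  rw [ENNReal.ofReal_div_of_pos (by positivity), ENNReal.ofReal_mul hn.le, ENNReal.ofReal_natCast,
    ENNReal.ofReal_natCast, ← toReal_cumE, ENNReal.ofReal_toReal (cumE_ne_top _ _), oldProb,
    div_eq_mul_inv, ENNReal.mul_inv (.inl (by simp [NeZero.ne n])) (.inl (by simp))]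
  ring

lemma oldProb_lt_one [NeZero n] {σ : PMF (Fin n)} (hσ : Star σ) {a : ℕ} (ha : a < n) :
    oldProb σ a < 1 := by
  rcases Nat.eq_zero_or_pos a with rfl | h0
  · simp [oldProb_zero]
  have h := hσ.lt_mul_cum h0 ha
  have ha' : (0 : ℝ) ≤ a := by positivity
  rw [oldProb_eq_ofReal hσ h0.ne', ENNReal.ofReal_lt_one, div_lt_one (by linarith)]
  exact h

lemma sum_ite_mem_const (A : Finset (Fin n)) (c : ℝ≥0∞) (d : Fin n → ℝ≥0∞) :
    ∑ x, (if x ∈ A then c else d x) = A.card * c + ∑ x ∈ Aᶜ, d x := by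
  rw [← Finset.sum_add_sum_compl A, Finset.sum_congr rfl fun x hx => if_pos hx, Finset.sum_const,
    nsmul_eq_mul]
  congr 1
  exact Finset.sum_congr rfl fun x hx => if_neg (Finset.mem_compl.1 hx)

lemma lintegral_weightUpTo_succ [NeZero n] (σ : PMF (Fin n)) (k : ℕ) (A : Finset (Fin n)) :
    ∫⁻ w, weightUpTo σ (k + 1) A w ∂iid n = oldProb σ A.card * ∫⁻ w, weightUpTo σ k A w ∂iid n +
      (n : ℝ≥0∞)⁻¹ * ∑ x ∈ Aᶜ, ∫⁻ w, weightUpTo σ k (insert x A) w ∂iid n := by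
  rw [lintegral_iid (by fun_prop)]
  have h : ∀ x, ∫⁻ w, weightUpTo σ (k + 1) A (cons x w) ∂iid n =
      if x ∈ A then (cumE σ A.card)⁻¹ * ∫⁻ w, weightUpTo σ k A w ∂iid n
      else ∫⁻ w, weightUpTo σ k (insert x A) w ∂iid n := by
    intro x
    simp only [weightUpTo_succ_cons]
    split_ifs
    · exact lintegral_const_mul _ (by fun_prop)
    · rfl
  simp only [h]
  rw [sum_ite_mem_const, mul_add, oldProb]
  ring

/-- First-step analysis: condition on the first letter, which is old or new. -/
lemma lintegral_weight_seen_succ [NeZero n] (σ : PMF (Fin n)) (p : Finset (Fin n) → Prop)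
    [DecidablePred p] (m : ℕ) (A : Finset (Fin n)) :
    ∫⁻ w, (if p (seen A w (m + 1)) then weight σ A w else 0) ∂iid n =
      oldProb σ A.card * ∫⁻ w, (if p (seen A w m) then weight σ A w else 0) ∂iid n +
      (n : ℝ≥0∞)⁻¹ * ∑ x ∈ Aᶜ,
        ∫⁻ w, (if p (seen (insert x A) w m) then weight σ (insert x A) w else 0) ∂iid n := by
  have hm : ∀ m A, Measurable fun w : ℕ → Fin n => if p (seen A w m) then weight σ A w else 0 :=
    fun m A => Measurable.ite (measurableSet_seen m A p) (by fun_prop) measurable_const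
  rw [lintegral_iid (hm _ _)]
  have h : ∀ x, ∫⁻ w, (if p (seen A (cons x w) (m + 1)) then weight σ A (cons x w) else 0) ∂iid n =
      if x ∈ A then (cumE σ A.card)⁻¹ * ∫⁻ w, (if p (seen A w m) then weight σ A w else 0) ∂iid n
      else ∫⁻ w, (if p (seen (insert x A) w m) then weight σ (insert x A) w else 0) ∂iid n := by
    intro x
    simp only [seen_cons_succ, weight_cons]
    split_ifs with hx
    · rw [Finset.insert_eq_of_mem hx, ← lintegral_const_mul _ (hm _ _)]
      simp only [mul_ite, mul_zero]
    · rfl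
  simp only [h]
  rw [sum_ite_mem_const, mul_add, oldProb]
  ring

lemma lintegral_weight_eq [NeZero n] (σ : PMF (Fin n)) (A : Finset (Fin n)) :
    ∫⁻ w, weight σ A w ∂iid n = oldProb σ A.card * ∫⁻ w, weight σ A w ∂iid n +
      (n : ℝ≥0∞)⁻¹ * ∑ x ∈ Aᶜ, ∫⁻ w, weight σ (insert x A) w ∂iid n := by
  simpa using lintegral_weight_seen_succ σ (fun _ => True) 0 A

/-- The condition on `σ` makes the weight integrable. -/
lemma lintegral_weight_ne_top [NeZero n] {σ : PMF (Fin n)} (hσ : Star σ) (A : Finset (Fin n)) :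
    ∫⁻ w, weight σ A w ∂iid n ≠ ∞ := by
  have key : ∀ b a : ℕ, a + b = n → ∃ B : ℝ≥0∞, B ≠ ∞ ∧ 1 ≤ B ∧ ∀ A : Finset (Fin n), A.card = a →
      ∀ k, ∫⁻ w, weightUpTo σ k A w ∂iid n ≤ B := by
    intro b
    induction b with
    | zero =>
      refine fun a ha => ⟨1, by simp, le_rfl, fun A hA k => ?_⟩
      have hu : A = Finset.univ := (Finset.card_eq_iff_eq_univ A).1 (by simp [hA]; omega)
      rw [hu]
      calc ∫⁻ w, weightUpTo σ k Finset.univ w ∂iid n ≤ ∫⁻ w, 1 ∂iid n := by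
            refine lintegral_mono fun w => ?_
            rw [← weight_univ σ w]
            exact le_iSup (fun k => weightUpTo σ k Finset.univ w) k
        _ = 1 := by simp
    | succ b ih =>
      intro a ha
      obtain ⟨B', hB', h1, hB⟩ := ih (a + 1) (by omega)
      have hρ := oldProb_lt_one hσ (show a < n by omega)
      have hsub : 1 - oldProb σ a ≠ 0 := (tsub_pos_of_lt hρ).ne'
      have hsub' : 1 - oldProb σ a ≠ ∞ := ENNReal.sub_ne_top (by simp)
      have hinv : (1 : ℝ≥0∞) ≤ (1 - oldProb σ a)⁻¹ := ENNReal.one_le_inv.2 tsub_le_self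
      refine ⟨(1 - oldProb σ a)⁻¹ * B', ENNReal.mul_ne_top (ENNReal.inv_ne_top.2 hsub) hB',
        one_le_mul hinv h1, fun A hA k => ?_⟩
      -- the bound is the fixed point of the first-step recursion
      have hfix : oldProb σ a * ((1 - oldProb σ a)⁻¹ * B') + B' = (1 - oldProb σ a)⁻¹ * B' := by
        calc _ = oldProb σ a * ((1 - oldProb σ a)⁻¹ * B') +
              (1 - oldProb σ a) * ((1 - oldProb σ a)⁻¹ * B') := by
              rw [← mul_assoc (1 - _), ENNReal.mul_inv_cancel hsub hsub', one_mul]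
          _ = _ := by rw [← add_mul, add_tsub_cancel_of_le hρ.le, one_mul]
      induction k with
      | zero => simpa [weightUpTo] using one_le_mul hinv h1
      | succ k ihk =>
        rw [lintegral_weightUpTo_succ, ← hfix, hA]
        gcongr
        calc (n : ℝ≥0∞)⁻¹ * ∑ x ∈ Aᶜ, ∫⁻ w, weightUpTo σ k (insert x A) w ∂iid n
            ≤ (n : ℝ≥0∞)⁻¹ * ∑ x ∈ Aᶜ, B' := by
              gcongr with x hx
              refine hB _ ?_ k
              rw [Finset.card_insert_of_notMem (Finset.mem_compl.1 hx), hA]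
          _ ≤ (n : ℝ≥0∞)⁻¹ * (n * B') := by
              rw [Finset.sum_const, nsmul_eq_mul]
              gcongr
              simpa using Finset.card_le_univ Aᶜ
          _ = B' := by
              rw [← mul_assoc, ENNReal.inv_mul_cancel (by simp [NeZero.ne n]) (by simp), one_mul]
  have hA : A.card ≤ n := by simpa using Finset.card_le_univ A
  obtain ⟨B, hB, -, h⟩ := key (n - A.card) A.card (by omega)
  refine ne_top_of_le_ne_top hB ?_
  simp only [weight]
  rw [lintegral_iSup (fun k => measurable_weightUpTo σ k A)
    fun i j hij w => weightUpTo_mono σ A w hij]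
  exact iSup_le fun k => h A rfl k

/-- Under the stationary distribution, the number of distinct letters among the first `m` letters
is a pure birth chain that stays in `a` with probability `oldProb σ a`. -/
lemma lintegral_weight_card_le [NeZero n] {σ : PMF (Fin n)} (hσ : Star σ) (i : Fin n)
    {h : ℕ → ℕ → ℝ≥0∞} (h0 : ∀ a ≤ i.val, h a 0 = 1) (hi : ∀ a, i.val < a → ∀ m, h a m = 0)
    (hs : ∀ a ≤ i.val, ∀ m,
      h a (m + 1) = oldProb σ a * h a m + (1 - oldProb σ a) * h (a + 1) m)
    (m : ℕ) (A : Finset (Fin n)) :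
    ∫⁻ w, (if (seen A w m).card ≤ i then weight σ A w else 0) ∂iid n =
      (∫⁻ w, weight σ A w ∂iid n) * h A.card m := by
  have hbig : ∀ m (A : Finset (Fin n)), i.val < A.card →
      ∫⁻ w, (if (seen A w m).card ≤ i then weight σ A w else 0) ∂iid n =
        (∫⁻ w, weight σ A w ∂iid n) * h A.card m := by
    intro m A hA
    have : ∀ w, ¬ (seen A w m).card ≤ i := fun w hw => by
      have h1 : A.card ≤ (seen A w m).card := Finset.card_le_card Finset.subset_union_left
      omega
    simp [this, hi _ hA]
  by_cases hA : i.val < A.card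
  · exact hbig m A hA
  push Not at hA
  induction m generalizing A with
  | zero => simp [hA, h0]
  | succ m ih =>
    have ih' : ∀ A : Finset (Fin n),
        ∫⁻ w, (if (seen A w m).card ≤ i then weight σ A w else 0) ∂iid n =
        (∫⁻ w, weight σ A w ∂iid n) * h A.card m := fun A =>
      if hA : i.val < A.card then hbig m A hA else ih A (not_lt.1 hA)
    rw [lintegral_weight_seen_succ σ (fun s => s.card ≤ i) m A]
    simp only [ih']
    set Z := ∫⁻ w, weight σ A w ∂iid n with hZ
    have hZt : Z ≠ ∞ := lintegral_weight_ne_top hσ A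
    have hρ := oldProb_lt_one hσ (show A.card < n by omega)
    have e1 : ∑ x ∈ Aᶜ, (∫⁻ w, weight σ (insert x A) w ∂iid n) * h (insert x A).card m =
        (∑ x ∈ Aᶜ, ∫⁻ w, weight σ (insert x A) w ∂iid n) * h (A.card + 1) m := by
      rw [Finset.sum_mul]
      refine Finset.sum_congr rfl fun x hx => ?_
      rw [Finset.card_insert_of_notMem (Finset.mem_compl.1 hx)]
    have e2 : (n : ℝ≥0∞)⁻¹ * ∑ x ∈ Aᶜ, ∫⁻ w, weight σ (insert x A) w ∂iid n =
        (1 - oldProb σ A.card) * Z := by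
      have h1 := lintegral_weight_eq σ A
      have h2 : Z = oldProb σ A.card * Z + (1 - oldProb σ A.card) * Z := by
        rw [← add_mul, add_tsub_cancel_of_le hρ.le, one_mul]
      have h3 : oldProb σ A.card * Z ≠ ∞ := ENNReal.mul_ne_top hρ.ne_top hZt
      exact (ENNReal.add_right_inj h3).1 (h1.symm.trans h2)
    rw [e1, ← mul_assoc (n : ℝ≥0∞)⁻¹, e2, hs _ hA]
    ring

/-! ### The stationary distribution -/

/-- The stationary distribution of the word. -/
noncomputable def stat (σ : PMF (Fin n)) : Measure (ℕ → Fin n) :=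
  (∫⁻ w, weight σ ∅ w ∂iid n)⁻¹ • (iid n).withDensity (weight σ ∅)

lemma lintegral_weight_ne_zero [NeZero n] (σ : PMF (Fin n)) (A : Finset (Fin n)) :
    ∫⁻ w, weight σ A w ∂iid n ≠ 0 := by
  have h : ∫⁻ _, 1 ∂iid n ≤ ∫⁻ w, weight σ A w ∂iid n := lintegral_mono fun w => one_le_weight σ A w
  intro h0
  rw [h0] at h
  simp at h

lemma isProbabilityMeasure_stat [NeZero n] {σ : PMF (Fin n)} (hσ : Star σ) :
    IsProbabilityMeasure (stat σ) := by
  refine ⟨?_⟩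
  rw [stat, Measure.smul_apply, withDensity_apply _ .univ, setLIntegral_univ, smul_eq_mul,
    ENNReal.inv_mul_cancel (lintegral_weight_ne_zero σ _) (lintegral_weight_ne_top hσ _)]

lemma step_stat [NeZero n] {σ : PMF (Fin n)} (hσ : Star σ) : step σ (stat σ) = stat σ := by
  rw [stat, step_smul, step_withDensity_weight hσ]

lemma iid_le_smul_stat [NeZero n] {σ : PMF (Fin n)} (hσ : Star σ) :
    iid n ≤ (∫⁻ w, weight σ ∅ w ∂iid n) • stat σ := by
  rw [stat, smul_smul, ENNReal.mul_inv_cancel (lintegral_weight_ne_zero σ _)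
    (lintegral_weight_ne_top hσ _), one_smul]
  refine Measure.le_intro fun s hs _ => ?_
  rw [withDensity_apply _ hs, ← setLIntegral_one]
  exact lintegral_mono fun w => one_le_weight σ ∅ w

lemma stat_le_pos [NeZero n] {σ : PMF (Fin n)} (hσ : Star σ) (i : Fin n)
    {h : ℕ → ℕ → ℝ≥0∞} (h0 : ∀ a ≤ i.val, h a 0 = 1) (hi : ∀ a, i.val < a → ∀ m, h a m = 0)
    (hs : ∀ a ≤ i.val, ∀ m,
      h a (m + 1) = oldProb σ a * h a m + (1 - oldProb σ a) * h (a + 1) m) (m : ℕ) :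
    stat σ {w | m ≤ pos i w} = h 0 m := by
  have hm : MeasurableSet {w : ℕ → Fin n | m ≤ pos i w} := measurable_pos i measurableSet_Ici
  have e : ∫⁻ w in {w | m ≤ pos i w}, weight σ ∅ w ∂iid n =
      ∫⁻ w, (if (seen ∅ w m).card ≤ i then weight σ ∅ w else 0) ∂iid n := by
    rw [← lintegral_indicator hm]
    refine lintegral_congr_ae ?_
    filter_upwards [ae_exists_eq (n := n)] with w hw
    simp only [Set.indicator_apply, Set.mem_ofPred_eq, le_pos_iff hw]
  rw [stat, Measure.smul_apply, withDensity_apply _ hm, e, lintegral_weight_card_le hσ i h0 hi hs,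
    smul_eq_mul, ← mul_assoc, ENNReal.inv_mul_cancel (lintegral_weight_ne_zero σ _)
    (lintegral_weight_ne_top hσ _), one_mul, Finset.card_empty]

/-! ### Measures with a fresh suffix -/

/-- Under the (possibly unnormalized) law `m`, the part of the word that follows a prefix
containing all letters is independent of that prefix, with independent uniform letters. -/
def FreshSuffix (m : Measure (ℕ → Fin n)) : Prop :=
  ∀ (k : ℕ) (B C : Set (ℕ → Fin n)), (∀ v w, (∀ j < k, v j = w j) → (v ∈ B ↔ w ∈ B)) →
    (∀ v ∈ B, seen ∅ v k = Finset.univ) → MeasurableSet C →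
    m (B ∩ drop k ⁻¹' C) = m B * iid n C

lemma FreshSuffix.add {m m' : Measure (ℕ → Fin n)} (h : FreshSuffix m) (h' : FreshSuffix m') :
    FreshSuffix (m + m') := fun k B C hB hk hC => by
  simp only [Measure.add_apply, h k B C hB hk hC, h' k B C hB hk hC, add_mul]

lemma FreshSuffix.smul {m : Measure (ℕ → Fin n)} (h : FreshSuffix m) (c : ℝ≥0∞) :
    FreshSuffix (c • m) := fun k B C hB hk hC => by
  simp only [Measure.smul_apply, h k B C hB hk hC, smul_eq_mul, mul_assoc]

lemma FreshSuffix.zero : FreshSuffix (0 : Measure (ℕ → Fin n)) := fun k B C hB hk hC => by simp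

lemma FreshSuffix.sum {ι : Type*} (s : Finset ι) {m : ι → Measure (ℕ → Fin n)}
    (h : ∀ i, FreshSuffix (m i)) : FreshSuffix (∑ i ∈ s, m i) := by
  classical
  induction s using Finset.induction_on with
  | empty => simpa using FreshSuffix.zero
  | insert i s hi ih => rw [Finset.sum_insert hi]; exact (h i).add ih

/-- A deletion takes place among the letters of any prefix that contains all letters, hence it
leaves the suffix untouched. -/
lemma FreshSuffix.map_delPos [NeZero n] {m : Measure (ℕ → Fin n)} (h : FreshSuffix m) (i : Fin n) :
    FreshSuffix (m.map (delPos i)) := by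
  intro k B C hB hk hC
  have hBm : MeasurableSet B := measurableSet_of_prefix (p := (· ∈ B)) k hB
  rw [Measure.map_apply (measurable_delPos i) (hBm.inter (measurable_drop k hC)),
    Measure.map_apply (measurable_delPos i) hBm]
  rw [← h (k + 1) _ C _ _ hC]
  · congr 1
    ext w
    simp only [Set.mem_preimage, Set.mem_inter_iff]
    refine and_congr_right fun hw => ?_
    rw [drop_delPos (pos_le_of_seen_delPos i (hk _ hw))]
  · have key : ∀ v w : ℕ → Fin n, (∀ j < k + 1, v j = w j) → delPos i v ∈ B → delPos i w ∈ B := by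
      intro v w hvw hv
      exact (hB _ _ (delPos_congr i hvw (seen_succ_of_seen_delPos i (hk _ hv)))).1 hv
    exact fun v w hvw => ⟨key v w hvw, key w v fun j hj => (hvw j hj).symm⟩
  · exact fun v hv => seen_succ_of_seen_delPos i (hk _ hv)

lemma FreshSuffix.step [NeZero n] {m : Measure (ℕ → Fin n)} (h : FreshSuffix m) (σ : PMF (Fin n)) :
    FreshSuffix (step σ m) :=
  FreshSuffix.sum _ fun i => (h.map_delPos i).smul _

lemma FreshSuffix.iterate_step [NeZero n] {m : Measure (ℕ → Fin n)} (h : FreshSuffix m)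
    (σ : PMF (Fin n)) (k : ℕ) : FreshSuffix ((MultiQueue.step σ)^[k] m) := by
  induction k with
  | zero => exact h
  | succ k ih => rw [Function.iterate_succ_apply']; exact ih.step σ

lemma FreshSuffix.restrict {m : Measure (ℕ → Fin n)} (h : FreshSuffix m) {D : Set (ℕ → Fin n)}
    (hDm : MeasurableSet D)
    (hD : ∀ v w k, seen ∅ v k = Finset.univ → (∀ j < k, v j = w j) → (v ∈ D ↔ w ∈ D)) :
    FreshSuffix (m.restrict D) := by
  intro k B C hB hk hC
  rw [Measure.restrict_apply' hDm, Measure.restrict_apply' hDm, ← h k (B ∩ D) C _ _ hC,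
    Set.inter_right_comm]
  · intro v w hvw
    by_cases hv : v ∈ B
    · exact and_congr (hB v w hvw) (hD v w k (hk v hv) hvw)
    · exact iff_of_false (fun h => hv h.1) fun h => hv ((hB v w hvw).2 h.1)
  · exact fun v hv => hk v hv.1

/-- The words all of whose letters occur among the first `k`. -/
def completeAt (n k : ℕ) : Set (ℕ → Fin n) := {w | seen ∅ w k = Finset.univ}

lemma measurableSet_completeAt [NeZero n] (k : ℕ) : MeasurableSet (completeAt n k) :=
  measurableSet_seen k ∅ (· = Finset.univ)

lemma completeAt_congr {v w : ℕ → Fin n} {j : ℕ} (k : ℕ) (hv : seen ∅ v j = Finset.univ)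
    (h : ∀ i < j, v i = w i) : v ∈ completeAt n k ↔ w ∈ completeAt n k := by
  rcases le_total j k with hjk | hkj
  · have hw : seen ∅ w j = Finset.univ := by rw [← seen_congr h, hv]
    have h1 : ∀ {u : ℕ → Fin n}, seen ∅ u j = Finset.univ → u ∈ completeAt n k := fun hu =>
      Finset.univ_subset_iff.1 (hu ▸ seen_mono ∅ _ hjk)
    exact iff_of_true (h1 hv) (h1 hw)
  · simp only [completeAt, Set.mem_ofPred_eq, seen_congr fun i hi => h i (lt_of_lt_of_le hi hkj)]

lemma FreshSuffix.restrict_completeAt [NeZero n] {m : Measure (ℕ → Fin n)} (h : FreshSuffix m)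
    (k : ℕ) : FreshSuffix (m.restrict (completeAt n k)) :=
  h.restrict (measurableSet_completeAt k) fun _ _ _ hv hvw => completeAt_congr k hv hvw

lemma FreshSuffix.restrict_compl_completeAt [NeZero n] {m : Measure (ℕ → Fin n)}
    (h : FreshSuffix m) (k : ℕ) : FreshSuffix (m.restrict (completeAt n k)ᶜ) :=
  h.restrict (measurableSet_completeAt k).compl fun _ _ _ hv hvw =>
    not_congr (completeAt_congr k hv hvw)

/-- A density that is determined by the letters up to the time all letters have occurred
produces a measure with a fresh suffix. -/
lemma freshSuffix_withDensity [NeZero n] {f : (ℕ → Fin n) → ℝ≥0∞} (hf : Measurable f)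
    (hfk : ∀ v w k, seen ∅ v k = Finset.univ → (∀ j < k, v j = w j) → f v = f w) :
    FreshSuffix ((iid n).withDensity f) := by
  intro k B C hB hk hC
  have hBm : MeasurableSet B := measurableSet_of_prefix (p := (· ∈ B)) k hB
  rw [withDensity_apply _ (hBm.inter (measurable_drop k hC)), withDensity_apply _ hBm,
    ← lintegral_indicator (hBm.inter (measurable_drop k hC)), ← lintegral_indicator hBm,
    ← lintegral_indicator_one hC, ← lintegral_mul_drop k (hf.indicator hBm) _
      (measurable_one.indicator hC)]
  · refine lintegral_congr fun w => ?_
    by_cases h1 : w ∈ B <;> by_cases h2 : drop k w ∈ C <;> simp [h1, h2]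
  · intro v w hvw
    by_cases hv : v ∈ B
    · rw [Set.indicator_of_mem hv, Set.indicator_of_mem ((hB v w hvw).1 hv),
        hfk v w k (hk v hv) hvw]
    · rw [Set.indicator_of_notMem hv, Set.indicator_of_notMem fun h => hv ((hB v w hvw).2 h)]

lemma freshSuffix_iid [NeZero n] : FreshSuffix (iid n) := by
  have h := freshSuffix_withDensity (n := n) (f := 1) measurable_one fun _ _ _ _ _ => rfl
  rwa [withDensity_one] at h

lemma freshSuffix_stat [NeZero n] (σ : PMF (Fin n)) : FreshSuffix (stat σ) :=
  (freshSuffix_withDensity (measurable_weight σ ∅) fun _ _ _ hv hvw =>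
    weight_congr σ hvw hv).smul _

/-! ### Convergence to the stationary distribution -/

lemma iterate_step_add [NeZero n] (σ : PMF (Fin n)) (k : ℕ) (m m' : Measure (ℕ → Fin n)) :
    (step σ)^[k] (m + m') = (step σ)^[k] m + (step σ)^[k] m' := by
  induction k with
  | zero => rfl
  | succ k ih => simp only [Function.iterate_succ_apply', ih, step_add]

lemma iterate_step_univ [NeZero n] (σ : PMF (Fin n)) (k : ℕ) (m : Measure (ℕ → Fin n)) :
    (step σ)^[k] m Set.univ = m Set.univ := by
  induction k with
  | zero => rfl
  | succ k ih => rw [Function.iterate_succ_apply', step_univ, ih]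

lemma iterate_step_mono [NeZero n] (σ : PMF (Fin n)) (k : ℕ) {m m' : Measure (ℕ → Fin n)}
    (h : m ≤ m') : (step σ)^[k] m ≤ (step σ)^[k] m' := by
  induction k with
  | zero => exact h
  | succ k ih =>
    simp only [Function.iterate_succ_apply']
    refine Measure.le_intro fun s hs _ => ?_
    simp only [step, Measure.finsetSum_apply, Measure.smul_apply, smul_eq_mul]
    gcongr with i
    exact measurable_delPos i

lemma iterate_step_smul_stat [NeZero n] {σ : PMF (Fin n)} (hσ : Star σ) (k : ℕ) (c : ℝ≥0∞) :
    (step σ)^[k] (c • stat σ) = c • stat σ :=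
  Function.iterate_fixed (by rw [step_smul, step_stat hσ]) k

/-- With positive probability, the first `k` deletions always select the first queue; together
they drop the first `k` letters. -/
lemma exists_iterate_step_eq [NeZero n] (σ : PMF (Fin n)) (k : ℕ) {m : Measure (ℕ → Fin n)}
    (h : FreshSuffix m) : ∃ r, FreshSuffix r ∧
      (step σ)^[k] m = σ 0 ^ k • m.map (drop k) + r := by
  have h0 : ∀ m : Measure (ℕ → Fin n), step σ m = σ 0 • m.map (drop 1) +
      ∑ i ∈ Finset.univ.erase 0, σ i • m.map (delPos i) := by
    intro m
    have e : (delPos ((0 : Fin n) : ℕ) : (ℕ → Fin n) → ℕ → Fin n) = drop 1 := by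
      funext w
      simp [delPos_zero]
    rw [step, ← Finset.add_sum_erase _ _ (Finset.mem_univ 0), e]
  have hfresh : ∀ k, FreshSuffix (m.map (drop k)) := by
    intro k
    induction k with
    | zero =>
      have : (drop 0 : (ℕ → Fin n) → ℕ → Fin n) = id := by funext w; simp
      rw [this, Measure.map_id]
      exact h
    | succ k ih =>
      have e : m.map (drop (k + 1)) = (m.map (drop k)).map (delPos ((0 : Fin n) : ℕ)) := by
        rw [Measure.map_map (measurable_delPos _) (measurable_drop k)]
        congr 1
        funext w
        simp [delPos_zero, drop_drop]
      rw [e]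
      exact ih.map_delPos 0
  induction k with
  | zero =>
    refine ⟨0, FreshSuffix.zero, ?_⟩
    have : (drop 0 : (ℕ → Fin n) → ℕ → Fin n) = id := by funext w; simp
    simp [this]
  | succ k ih =>
    obtain ⟨r, hr, e⟩ := ih
    refine ⟨σ 0 ^ k • ∑ i ∈ Finset.univ.erase 0, σ i • (m.map (drop k)).map (delPos i) + step σ r,
      ((FreshSuffix.sum _ fun i => ((hfresh k).map_delPos i).smul _).smul _).add (hr.step σ), ?_⟩
    have e2 : (m.map (drop k)).map (drop 1) = m.map (drop (k + 1)) := by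
      rw [Measure.map_map (measurable_drop 1) (measurable_drop k)]
      congr 1
      funext w
      simp [drop_drop]
    rw [Function.iterate_succ_apply', e, step_add, step_smul, h0, e2, smul_add, smul_smul, pow_succ,
      add_assoc]

/-- A minorization condition: from words that are complete at `k`, the law of the word is
renewed within `k` deletions with positive probability. -/
lemma exists_iterate_step_eq_smul_iid [NeZero n] (σ : PMF (Fin n)) (k : ℕ)
    {m : Measure (ℕ → Fin n)} (h : FreshSuffix m) {c : ℝ≥0∞}
    (hc : c ≤ m (completeAt n k)) :
    ∃ r, FreshSuffix r ∧ (step σ)^[k] m = (σ 0 ^ k * c) • iid n + r := by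
  have hK := measurableSet_completeAt (n := n) k
  obtain ⟨r, hr, e⟩ := exists_iterate_step_eq σ k (h.restrict_completeAt k)
  have e1 : (m.restrict (completeAt n k)).map (drop k) = m (completeAt n k) • iid n := by
    ext C hC
    rw [Measure.map_apply (measurable_drop k) hC, Measure.restrict_apply' hK, Set.inter_comm,
      h k (completeAt n k) C (fun v w hvw => by
        simp only [completeAt, Set.mem_ofPred_eq, seen_congr hvw]) (fun v hv => hv) hC]
    rfl
  refine ⟨(σ 0 ^ k * (m (completeAt n k) - c)) • iid n + r +
    (step σ)^[k] (m.restrict (completeAt n k)ᶜ),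
    ((freshSuffix_iid.smul _).add hr).add ((h.restrict_compl_completeAt k).iterate_step σ k), ?_⟩
  conv_lhs => rw [← Measure.restrict_add_restrict_compl (μ := m) hK]
  rw [iterate_step_add, e, e1, smul_smul, ← add_assoc, ← add_assoc, ← add_smul, ← mul_add,
    add_tsub_cancel_of_le hc]

lemma exists_stat_compl_completeAt_le [NeZero n] {σ : PMF (Fin n)} (hσ : Star σ) {ε : ℝ≥0∞}
    (hε : ε ≠ 0) : ∃ k, stat σ (completeAt n k)ᶜ ≤ ε := by
  have := isProbabilityMeasure_stat hσ
  have h : Tendsto (fun k => stat σ (completeAt n k)ᶜ) atTop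
      (nhds (stat σ (⋂ k, (completeAt n k)ᶜ))) := by
    refine tendsto_measure_iInter_atTop
      (fun k => (measurableSet_completeAt k).compl.nullMeasurableSet) ?_ ⟨0, measure_ne_top _ _⟩
    intro j k hjk w hw hw'
    exact hw (Finset.univ_subset_iff.1 ((show seen ∅ w j = Finset.univ from hw') ▸
      seen_mono ∅ _ hjk))
  have h0 : stat σ (⋂ k, (completeAt n k)ᶜ) = 0 := by
    have hac : stat σ ≪ iid n :=
      (withDensity_absolutelyContinuous _ _).smul_left _
    refine hac ?_
    refine measure_mono_null (fun w hw => ?_) (ae_iff.1 (ae_exists_eq (n := n)))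
    intro hw'
    obtain ⟨k, hk⟩ := exists_seen_eq_univ hw'
    exact Set.mem_iInter.1 hw k hk
  rw [h0] at h
  obtain ⟨k, hk⟩ := (h.eventually (gt_mem_nhds (pos_iff_ne_zero.2 hε))).exists
  exact ⟨k, hk.le⟩

lemma le_completeAt_of_compl_le [NeZero n] {m : Measure (ℕ → Fin n)} {k : ℕ} {ε : ℝ≥0∞}
    (hε : ε ≠ ∞) (h : m (completeAt n k)ᶜ ≤ ε) (h2 : ε + ε ≤ m Set.univ) :
    ε ≤ m (completeAt n k) := by
  rw [← measure_add_measure_compl (measurableSet_completeAt k)] at h2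
  exact (ENNReal.add_le_add_iff_right hε).1 (h2.trans (add_le_add_right h _))

/-- The law of the word and the stationary distribution coincide up to measures `α`, `β` whose
common mass decreases by a fixed amount every `k` deletions, as long as it exceeds `2 ε`. -/
lemma exists_coupling [NeZero n] {σ : PMF (Fin n)} (hσ : Star σ) {ε : ℝ≥0∞} (hε : ε ≠ 0)
    (hε' : ε ≠ ∞) : ∃ c : ℝ≥0∞, c ≠ 0 ∧ ∃ k, ∀ j : ℕ, ∃ γ α β : Measure (ℕ → Fin n),
      FreshSuffix α ∧ FreshSuffix β ∧ (step σ)^[k * j] (iid n) = γ + α ∧ stat σ = γ + β ∧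
      (α Set.univ ≤ ε + ε ∨ j * c + α Set.univ ≤ 1) := by
  have := isProbabilityMeasure_stat hσ
  set Z := ∫⁻ w, weight σ ∅ w ∂iid n with hZ
  have hZ0 : Z ≠ 0 := lintegral_weight_ne_zero σ ∅
  have hZt : Z ≠ ∞ := lintegral_weight_ne_top hσ ∅
  have hZ1 : 1 ≤ Z := by
    have h : ∫⁻ _, 1 ∂iid n ≤ Z := lintegral_mono fun w => one_le_weight σ ∅ w
    simpa using h
  obtain ⟨k, hk⟩ := exists_stat_compl_completeAt_le hσ
    (ε := Z⁻¹ * ε) (mul_ne_zero (ENNReal.inv_ne_zero.2 hZt) hε)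
  have hk1 : Z * stat σ (completeAt n k)ᶜ ≤ ε := by
    calc Z * stat σ (completeAt n k)ᶜ ≤ Z * (Z⁻¹ * ε) := by gcongr
      _ = ε := by rw [← mul_assoc, ENNReal.mul_inv_cancel hZ0 hZt, one_mul]
  have hk2 : stat σ (completeAt n k)ᶜ ≤ ε :=
    le_trans (le_mul_of_one_le_left zero_le hZ1) hk1
  refine ⟨σ 0 ^ k * ε, mul_ne_zero (pow_ne_zero _ hσ.apply_zero_ne_zero) hε, k, fun j => ?_⟩
  induction j with
  | zero => exact ⟨0, iid n, stat σ, freshSuffix_iid, freshSuffix_stat σ, by simp, by simp,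
      .inr (by simp)⟩
  | succ j ih =>
    obtain ⟨γ, α, β, hα, hβ, e1, e2, h⟩ := ih
    have e1' : (step σ)^[k * (j + 1)] (iid n) = (step σ)^[k] γ + (step σ)^[k] α := by
      rw [mul_add, mul_one, add_comm, Function.iterate_add_apply, e1, iterate_step_add]
    have e2' : stat σ = (step σ)^[k] γ + (step σ)^[k] β := by
      rw [← iterate_step_add, ← e2]
      exact (Function.iterate_fixed (step_stat hσ) k).symm
    rcases le_or_gt (α Set.univ) (ε + ε) with hle | hgt
    · exact ⟨_, _, _, hα.iterate_step σ k, hβ.iterate_step σ k, e1', e2',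
        .inl (by rwa [iterate_step_univ])⟩
    have h := h.resolve_left hgt.not_ge
    have hγ : γ Set.univ ≠ ∞ := by
      have h1 : stat σ Set.univ = γ Set.univ + β Set.univ := by rw [e2]; rfl
      exact ne_top_of_le_ne_top (measure_ne_top (stat σ) Set.univ) (h1 ▸ le_self_add)
    have hαβ : α Set.univ = β Set.univ := by
      have h1 : stat σ Set.univ = γ Set.univ + β Set.univ := by rw [e2]; rfl
      have h2 : (step σ)^[k * j] (iid n) Set.univ = γ Set.univ + α Set.univ := by rw [e1]; rfl
      rw [iterate_step_univ, measure_univ] at h2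
      rw [measure_univ] at h1
      exact (ENNReal.add_right_inj hγ).1 (h2.symm.trans h1)
    -- domination by the stationary measure keeps the incomplete words unlikely
    have hαK : α (completeAt n k)ᶜ ≤ ε := by
      refine le_trans ?_ hk1
      have h1 : (step σ)^[k * j] (iid n) ≤ Z • stat σ := by
        rw [← iterate_step_smul_stat hσ (k * j) Z]
        exact iterate_step_mono σ _ (iid_le_smul_stat hσ)
      refine le_trans ?_ (h1 _)
      rw [e1, Measure.add_apply]
      exact le_add_self
    have hβK : β (completeAt n k)ᶜ ≤ ε := by
      refine le_trans ?_ hk2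
      rw [e2, Measure.add_apply]
      exact le_add_self
    obtain ⟨α', hα', eα⟩ := exists_iterate_step_eq_smul_iid σ k hα
      (le_completeAt_of_compl_le hε' hαK hgt.le)
    obtain ⟨β', hβ', eβ⟩ := exists_iterate_step_eq_smul_iid σ k hβ
      (le_completeAt_of_compl_le hε' hβK (hαβ ▸ hgt.le))
    refine ⟨(step σ)^[k] γ + (σ 0 ^ k * ε) • iid n, α', β', hα', hβ', ?_, ?_, .inr ?_⟩
    · rw [e1', eα, add_assoc]
    · rw [add_assoc, ← eβ, ← e2']
    · have h3 : α Set.univ = σ 0 ^ k * ε + α' Set.univ := by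
        rw [← iterate_step_univ σ k α, eα]
        simp
      rw [h3] at h
      push_cast
      rw [add_mul, one_mul, add_assoc]
      exact h

/-- The law of the word converges to the stationary distribution. -/
theorem tendsto_iterate_step [NeZero n] {σ : PMF (Fin n)} (hσ : Star σ) (B : Set (ℕ → Fin n)) :
    Tendsto (fun s => (step σ)^[s] (iid n) B) atTop (nhds (stat σ B)) := by
  have := isProbabilityMeasure_stat hσ
  rw [ENNReal.tendsto_atTop (measure_ne_top _ _)]
  intro ε' hε'
  obtain ⟨ε, hε, hεt, hεε⟩ : ∃ ε : ℝ≥0∞, ε ≠ 0 ∧ ε ≠ ∞ ∧ ε + ε ≤ ε' := by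
    refine ⟨min (ε' / 2) 1, ?_, ?_, ?_⟩
    · simp [hε'.ne']
    · simp
    · calc _ ≤ ε' / 2 + ε' / 2 := by gcongr <;> exact min_le_left _ _
        _ = ε' := ENNReal.add_halves ε'
  obtain ⟨c, hc, k, h⟩ := exists_coupling hσ hε hεt
  obtain ⟨j, hj⟩ : ∃ j : ℕ, 1 < j * c := ENNReal.exists_nat_mul_gt hc (by simp)
  obtain ⟨γ, α, β, -, -, e1, e2, h⟩ := h j
  have hα : α Set.univ ≤ ε' := by
    refine (h.resolve_right fun h' => ?_).trans hεε
    exact (hj.trans_le (le_self_add.trans h')).false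
  have hβ : β Set.univ ≤ ε' := by
    have h1 : stat σ Set.univ = γ Set.univ + β Set.univ := by rw [e2]; rfl
    have h2 : (step σ)^[k * j] (iid n) Set.univ = γ Set.univ + α Set.univ := by rw [e1]; rfl
    rw [iterate_step_univ, measure_univ] at h2
    rw [measure_univ] at h1
    have hγ : γ Set.univ ≠ ∞ := ne_top_of_le_ne_top ENNReal.one_ne_top (h1 ▸ le_self_add)
    rwa [(ENNReal.add_right_inj hγ).1 (h1.symm.trans h2)]
  refine ⟨k * j, fun t ht => ?_⟩
  obtain ⟨u, rfl⟩ := Nat.exists_eq_add_of_le ht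
  have e1' : (step σ)^[k * j + u] (iid n) = (step σ)^[u] γ + (step σ)^[u] α := by
    rw [add_comm, Function.iterate_add_apply, e1, iterate_step_add]
  have e2' : stat σ = (step σ)^[u] γ + (step σ)^[u] β := by
    rw [← iterate_step_add, ← e2]
    exact (Function.iterate_fixed (step_stat hσ) u).symm
  have hα' : (step σ)^[u] α B ≤ ε' :=
    (measure_mono (Set.subset_univ _)).trans (by rwa [iterate_step_univ])
  have hβ' : (step σ)^[u] β B ≤ ε' :=
    (measure_mono (Set.subset_univ _)).trans (by rwa [iterate_step_univ])
  have f1 : (step σ)^[k * j + u] (iid n) B = (step σ)^[u] γ B + (step σ)^[u] α B := by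
    rw [e1']; rfl
  have f2 : stat σ B = (step σ)^[u] γ B + (step σ)^[u] β B := by
    conv_lhs => rw [e2']
    rfl
  rw [f1, f2]
  constructor
  · rw [tsub_le_iff_right]
    calc _ ≤ (step σ)^[u] γ B + ε' := by gcongr
      _ ≤ _ := by gcongr; exact le_self_add
  · calc _ ≤ (step σ)^[u] γ B + ε' := by gcongr
      _ ≤ _ := by gcongr; exact le_self_add

/-! ### From queues to words -/

/-- The word of the labels of the present elements, in ascending order, after `s` deletions. -/
noncomputable def wordAfter (a c : ℕ → Fin n) : ℕ → ℕ → Fin n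
  | 0 => a
  | s + 1 => delPos (c s) (wordAfter a c s)

/-- The present elements are `e 0 < e 1 < …`, and the `i`-th queue contains those whose letter
in `w` is `τ i`. -/
def Represents (e : ℕ → ℕ) (τ : Equiv.Perm (Fin n)) (w : ℕ → Fin n) (Q : Fin n → Set ℕ) : Prop :=
  StrictMono e ∧ ∀ i, Q i = e '' {k | w k = τ i}

lemma Represents.isLeast {e : ℕ → ℕ} {τ : Equiv.Perm (Fin n)} {w : ℕ → Fin n} {Q : Fin n → Set ℕ}
    (h : Represents e τ w Q) {i : Fin n} {p : ℕ} (hp : IsLeast {k | w k = τ i} p) :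
    top Q i = e p := by
  have : IsLeast (Q i) (e p) := by
    rw [h.2 i]
    exact h.1.monotone.map_isLeast hp
  exact this.csInf_eq

lemma exists_isLeast {w : ℕ → Fin n} (hw : ∀ x, ∃ k, w k = x) (x : Fin n) :
    ∃ p, IsLeast {k | w k = x} p :=
  ⟨sInf {k | w k = x}, Nat.sInf_mem (s := {k | w k = x}) (hw x), fun _ hk => Nat.sInf_le hk⟩

lemma Represents.relabel {e : ℕ → ℕ} {τ : Equiv.Perm (Fin n)} {w : ℕ → Fin n} {Q : Fin n → Set ℕ}
    (h : Represents e τ w Q) (hw : ∀ x, ∃ k, w k = x) :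
    Represents e ((Tuple.sort (top Q)).trans τ) w (relabel Q) ∧ StrictMono (top (relabel Q)) := by
  have hinj : Function.Injective (top Q) := by
    intro i j hij
    obtain ⟨p, hp⟩ := exists_isLeast hw (τ i)
    obtain ⟨q, hq⟩ := exists_isLeast hw (τ j)
    rw [h.isLeast hp, h.isLeast hq] at hij
    have hpq := h.1.injective hij
    have h1 : w p = τ i := hp.1
    have h2 : w q = τ j := hq.1
    exact τ.injective (by rw [← h1, ← h2, hpq])
  refine ⟨⟨h.1, fun i => h.2 _⟩, ?_⟩
  have hm : Monotone (top Q ∘ Tuple.sort (top Q)) := Tuple.monotone_sort (top Q)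
  exact hm.strictMono_of_injective (hinj.comp (Equiv.injective _))

/-- In a sorted configuration, the top-element of the `i`-th queue is at the first occurrence of
the `i`-th distinct letter. -/
lemma Represents.isLeast_pos {e : ℕ → ℕ} {τ : Equiv.Perm (Fin n)} {w : ℕ → Fin n}
    {Q : Fin n → Set ℕ} (h : Represents e τ w Q) (hw : ∀ x, ∃ k, w k = x)
    (hQ : StrictMono (top Q)) (i : Fin n) : IsLeast {k | w k = τ i} (pos i w) := by
  choose p hp using fun j => exists_isLeast hw (τ j)
  have hpm : ∀ j j', p j < p j' ↔ j < j' := fun j j' => by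
    rw [← hQ.lt_iff_lt, h.isLeast (hp j), h.isLeast (hp j'), h.1.lt_iff_lt]
  have hseen : ∀ k, seen ∅ w k = (Finset.univ.filter fun j => p j < k).map τ.toEmbedding := by
    intro k
    ext x
    obtain ⟨j, rfl⟩ := τ.surjective x
    simp only [mem_seen, Finset.notMem_empty, false_or, Finset.mem_map_equiv,
      Equiv.symm_apply_apply, Finset.mem_filter, Finset.mem_univ, true_and]
    exact ⟨fun ⟨q, hq, e⟩ => lt_of_le_of_lt ((hp j).2 e) hq, fun hk => ⟨p j, hk, (hp j).1⟩⟩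
  have h1 : (seen ∅ w (p i)).card = i := by
    rw [hseen, Finset.card_map]
    simp only [hpm]
    rw [Finset.filter_gt_eq_Iio, Fin.card_Iio]
  have h2 : (seen ∅ w (p i + 1)).card = i + 1 := by
    rw [seen_succ, Finset.card_insert_of_notMem, h1]
    intro hm
    obtain ⟨q, hq, e⟩ := (mem_seen.1 hm).resolve_left (by simp)
    have h3 : w q = τ i := e.trans (hp i).1
    exact absurd ((hp i).2 h3) (not_le.2 hq)
  have h3 : p i ≤ pos i w := (le_pos_iff hw i _).2 h1.le
  have h4 : ¬ p i + 1 ≤ pos i w := fun h => by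
    have := (le_pos_iff hw i _).1 h
    omega
  rw [show pos i w = p i by omega]
  exact hp i

lemma Represents.topRank_eq {e : ℕ → ℕ} {τ : Equiv.Perm (Fin n)} {w : ℕ → Fin n}
    {Q : Fin n → Set ℕ} (h : Represents e τ w Q) (hw : ∀ x, ∃ k, w k = x)
    (hQ : StrictMono (top Q)) (i : Fin n) : topRank Q i = pos i w + 1 := by
  have e1 : {y | y ∈ ⋃ j, Q j ∧ y ≤ top Q i} = e '' (Finset.range (pos i w + 1) : Set ℕ) := by
    rw [h.isLeast (h.isLeast_pos hw hQ i)]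
    ext y
    simp only [h.2, Set.mem_ofPred_eq, Set.mem_iUnion, Set.mem_image, Finset.mem_coe,
      Finset.mem_range, Nat.lt_succ_iff]
    constructor
    · rintro ⟨⟨j, k, -, rfl⟩, hk⟩
      exact ⟨k, h.1.le_iff_le.1 hk, rfl⟩
    · rintro ⟨k, hk, rfl⟩
      exact ⟨⟨τ.symm (w k), k, by simp, rfl⟩, h.1.monotone hk⟩
  rw [topRank, e1, Set.ncard_image_of_injective _ h.1.injective, Set.ncard_coe_finset,
    Finset.card_range]

lemma Represents.deleteTop {e : ℕ → ℕ} {τ : Equiv.Perm (Fin n)} {w : ℕ → Fin n}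
    {Q : Fin n → Set ℕ} (h : Represents e τ w Q) (hw : ∀ x, ∃ k, w k = x)
    (hQ : StrictMono (top Q)) (i : Fin n) :
    ∃ e', Represents e' τ (delPos i w) (deleteTop Q i) := by
  have hp := h.isLeast_pos hw hQ i
  set p := pos i w with hpdef
  -- the enumeration of the remaining elements skips the `p`-th one
  set skip : ℕ → ℕ := fun k => if k < p then k else k + 1 with hskip
  have hsm : StrictMono skip := by
    intro j k hjk
    simp only [hskip]
    split_ifs <;> omega
  have hdel : ∀ k, delPos i w k = w (skip k) := by
    intro k
    simp only [delPos, del, hskip, ← hpdef]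
    split_ifs <;> rfl
  have hrange : ∀ k, k ≠ p → ∃ j, skip j = k := by
    intro k hk
    rcases lt_or_gt_of_ne hk with hk | hk
    · exact ⟨k, by simp [hskip, hk]⟩
    · refine ⟨k - 1, ?_⟩
      simp only [hskip, show ¬ k - 1 < p by omega, if_false]
      omega
  have hne : ∀ k, skip k ≠ p := by
    intro k
    simp only [hskip]
    split_ifs <;> omega
  refine ⟨e ∘ skip, h.1.comp hsm, fun j => ?_⟩
  have key : (e ∘ skip) '' {k | delPos i w k = τ j} = e '' ({k | w k = τ j} \ {p}) := by
    rw [Set.image_comp]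
    congr 1
    ext k
    simp only [Set.mem_image, Set.mem_ofPred_eq, Set.mem_sdiff, Set.mem_singleton_iff, hdel]
    constructor
    · rintro ⟨m, hm, rfl⟩
      exact ⟨hm, hne m⟩
    · rintro ⟨hk, hkp⟩
      obtain ⟨m, rfl⟩ := hrange k hkp
      exact ⟨m, hk, rfl⟩
  rw [key, MultiQueue.deleteTop]
  by_cases hij : j = i
  · subst hij
    rw [Function.update_self, h.isLeast hp, h.2, Set.image_sdiff h.1.injective,
      Set.image_singleton]
  · rw [Function.update_of_ne hij, h.2, Set.sdiff_singleton_eq_self]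
    intro hm
    have h1 : w p = τ j := hm
    have h2 : w p = τ i := hp.1
    exact hij (τ.injective (h1.symm.trans h2))

lemma wordAfter_exists {a : ℕ → Fin n} (c : ℕ → Fin n) (ha : ∀ x k, ∃ j, k ≤ j ∧ a j = x) (s : ℕ) :
    ∀ x k, ∃ j, k ≤ j ∧ wordAfter a c s j = x := by
  induction s with
  | zero => exact ha
  | succ s ih => exact exists_delPos_eq ih (c s)

lemma exists_represents_queues {a : ℕ → Fin n} (c : ℕ → Fin n)
    (ha : ∀ x k, ∃ j, k ≤ j ∧ a j = x) (s : ℕ) :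
    ∃ e τ, Represents e τ (wordAfter a c s) (queues a c s) ∧ StrictMono (top (queues a c s)) := by
  have hocc : ∀ s x, ∃ k, wordAfter a c s k = x := fun s x =>
    let ⟨j, _, hj⟩ := wordAfter_exists c ha s x 0
    ⟨j, hj⟩
  induction s with
  | zero =>
    have h : Represents id (Equiv.refl _) a (fun j => {k | a k = j}) :=
      ⟨strictMono_id, fun i => by simp⟩
    exact ⟨_, _, h.relabel (hocc 0)⟩
  | succ s ih =>
    obtain ⟨e, τ, h, hQ⟩ := ih
    obtain ⟨e', h'⟩ := h.deleteTop (hocc s) hQ (c s)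
    exact ⟨_, _, h'.relabel (hocc (s + 1))⟩

/-- The rank error is the position of the deleted letter. -/
lemma rankError_eq_pos {a : ℕ → Fin n} (c : ℕ → Fin n)
    (ha : ∀ x k, ∃ j, k ≤ j ∧ a j = x) (s : ℕ) :
    rankError a c s = pos (c s) (wordAfter a c s) := by
  obtain ⟨e, τ, h, hQ⟩ := exists_represents_queues c ha s
  rw [rankError, h.topRank_eq (fun x => ?_) hQ, Nat.add_sub_cancel]
  obtain ⟨j, -, hj⟩ := wordAfter_exists c ha s x 0
  exact ⟨j, hj⟩

/-! ### The law of the rank error -/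

/-- The law of `g X Y`, where `X` has law `σ` and `Y` is independent of `X`. -/
lemma map_eq_sum_of_indepFun {Ω β γ : Type*} [MeasurableSpace Ω] [MeasurableSpace β]
    [MeasurableSpace γ] {μ : Measure Ω} {σ : PMF (Fin n)} {X : Ω → Fin n} {Y : Ω → β}
    (hX : HasLaw X σ.toMeasure μ) (hY : AEMeasurable Y μ) (h : IndepFun X Y μ)
    {g : Fin n → β → γ} (hg : ∀ i, Measurable (g i)) :
    AEMeasurable (fun ω => g (X ω) (Y ω)) μ ∧
      μ.map (fun ω => g (X ω) (Y ω)) = ∑ i, σ i • (μ.map Y).map (g i) := by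
  have hm : AEMeasurable (fun ω => g (X ω) (Y ω)) μ := by
    have : Measurable fun p : Fin n × β => g p.1 p.2 := measurable_from_prod_countable_right hg
    exact this.comp_aemeasurable (hX.aemeasurable.prodMk hY)
  refine ⟨hm, ?_⟩
  ext B hB
  have hU : (fun ω => g (X ω) (Y ω)) ⁻¹' B = ⋃ i ∈ Finset.univ, X ⁻¹' {i} ∩ Y ⁻¹' (g i ⁻¹' B) := by
    ext ω
    simp
  rw [Measure.map_apply_of_aemeasurable hm hB, hU, measure_biUnion_finset₀]
  · rw [Measure.finsetSum_apply]
    refine Finset.sum_congr rfl fun i _ => ?_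
    rw [h.measure_inter_preimage_eq_mul _ _ (measurableSet_singleton i) (hg i hB),
      Measure.smul_apply, Measure.map_apply (hg i) hB,
      Measure.map_apply_of_aemeasurable hY (hg i hB), smul_eq_mul,
      ← Measure.map_apply_of_aemeasurable hX.aemeasurable (measurableSet_singleton i), hX.map_eq,
      PMF.toMeasure_apply_singleton _ _ (measurableSet_singleton i)]
  · intro i _ j _ hij
    refine Disjoint.aedisjoint (Set.disjoint_left.2 fun ω h1 h2 => hij ?_)
    exact h1.1.symm.trans h2.1
  · intro i _
    exact (hX.aemeasurable.nullMeasurable (measurableSet_singleton i)).inter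
      (hY.nullMeasurable (hg i hB))

/-- The random word after `s` deletions is a function of the initial word and the first `s`
choices. -/
lemma measurable_wordAfter_iSup [NeZero n] {Ω : Type*} {A I : ℕ → Ω → Fin n} (s : ℕ) :
    Measurable[⨆ i ∈ {i : ℕ ⊕ ℕ | ∀ t, i = .inr t → t < s},
      MeasurableSpace.comap (Sum.elim A I i) inferInstance]
      fun ω => wordAfter (fun k => A k ω) (fun t => I t ω) s := by
  have hle : ∀ s (i : ℕ ⊕ ℕ), (∀ t, i = .inr t → t < s) →
      Measurable[⨆ i ∈ {i : ℕ ⊕ ℕ | ∀ t, i = .inr t → t < s},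
        MeasurableSpace.comap (Sum.elim A I i) inferInstance] (Sum.elim A I i) := by
    intro s i hi
    refine (comap_measurable _).mono ?_ le_rfl
    exact le_iSup₂_of_le i hi le_rfl
  induction s with
  | zero =>
    refine @measurable_pi_lambda _ _ _ (_) _ _ fun k => ?_
    exact hle 0 (.inl k) (by simp)
  | succ s ih =>
    have h1 := hle (s + 1) (.inr s) (by simp)
    have h2 := ih.mono (ma' := ⨆ i ∈ {i : ℕ ⊕ ℕ | ∀ t, i = .inr t → t < s + 1},
        MeasurableSpace.comap (Sum.elim A I i) inferInstance)
      (biSup_mono fun i hi t ht => (hi t ht).trans (Nat.lt_succ_self s)) le_rfl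
    have h3 : Measurable fun p : Fin n × (ℕ → Fin n) => delPos p.1 p.2 :=
      measurable_from_prod_countable_right fun i => measurable_delPos i
    exact h3.comp (@Measurable.prodMk _ _ _ _ _ (_) _ _ h1 h2)

section Input

variable {Ω : Type*} [MeasurableSpace Ω] {μ : Measure Ω} {σ : PMF (Fin n)} {A I : ℕ → Ω → Fin n}

lemma IsInput.indepFun_wordAfter [NeZero n] (h : IsInput σ μ A I) (hA : ∀ k, Measurable (A k))
    (hI : ∀ t, Measurable (I t)) (s : ℕ) :
    IndepFun (I s) (fun ω => wordAfter (fun k => A k ω) (fun t => I t ω) s) μ := by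
  have hm : ∀ i : ℕ ⊕ ℕ, Measurable (Sum.elim A I i) := by
    rintro (k | t)
    · exact hA k
    · exact hI t
  have hi := indep_iSup_of_disjoint (fun i => (hm i).comap_le) h.indep
    (S := {.inr s}) (T := {i : ℕ ⊕ ℕ | ∀ t, i = .inr t → t < s})
    (Set.disjoint_singleton_left.2 fun h => (h s rfl).false)
  rw [IndepFun_iff_Indep]
  refine indep_of_indep_of_le_left (indep_of_indep_of_le_right hi ?_) ?_
  · exact (measurable_wordAfter_iSup s).comap_le
  · exact le_iSup₂_of_le (Sum.inr s) rfl le_rfl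

lemma measurable_wordAfter [NeZero n] (hA : ∀ k, Measurable (A k))
    (hI : ∀ t, Measurable (I t)) (s : ℕ) :
    Measurable fun ω => wordAfter (fun k => A k ω) (fun t => I t ω) s := by
  refine (measurable_wordAfter_iSup (A := A) (I := I) s).mono (iSup₂_le fun i _ => ?_) le_rfl
  rcases i with k | t
  · exact (hA k).comap_le
  · exact (hI t).comap_le

lemma IsInput.map_wordAfter [NeZero n] (h : IsInput σ μ A I) (hA : ∀ k, Measurable (A k))
    (hI : ∀ t, Measurable (I t)) (s : ℕ) :
    μ.map (fun ω => wordAfter (fun k => A k ω) (fun t => I t ω) s) = (step σ)^[s] (iid n) := by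
  induction s with
  | zero =>
    exact ((h.indep.precomp Sum.inl_injective).hasLaw_infinitePi h.law_element
      (measurable_pi_iff.2 hA).aemeasurable).map_eq
  | succ s ih =>
    rw [Function.iterate_succ_apply', ← ih, step]
    exact (map_eq_sum_of_indepFun (h.law_choice s) (measurable_wordAfter hA hI s).aemeasurable
      (h.indepFun_wordAfter hA hI s) (g := fun i w => delPos i w) fun i => measurable_delPos i).2

lemma IsInput.map_rankError_of_measurable [NeZero n] (h : IsInput σ μ A I)
    (hA : ∀ k, Measurable (A k)) (hI : ∀ t, Measurable (I t)) (s : ℕ) :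
    AEMeasurable (fun ω => rankError (fun k => A k ω) (fun t => I t ω) s) μ ∧
    μ.map (fun ω => rankError (fun k => A k ω) (fun t => I t ω) s) =
      ∑ i, σ i • ((step σ)^[s] (iid n)).map (pos i) := by
  have h1 := map_eq_sum_of_indepFun (h.law_choice s)
    (measurable_wordAfter hA hI s).aemeasurable (h.indepFun_wordAfter hA hI s)
    (g := fun i w => pos i w) fun i => measurable_pos i
  have hae : ∀ᵐ ω ∂μ, ∀ x k, ∃ j, k ≤ j ∧ A j ω = x := by
    have h0 := ae_exists_le_eq (n := n)
    have hmap : μ.map (fun ω k => A k ω) = iid n := h.map_wordAfter hA hI 0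
    rw [← hmap] at h0
    exact ae_of_ae_map (measurable_pi_iff.2 hA).aemeasurable h0
  have e : (fun ω => rankError (fun k => A k ω) (fun t => I t ω) s) =ᵐ[μ]
      fun ω => pos (I s ω) (wordAfter (fun k => A k ω) (fun t => I t ω) s) := by
    filter_upwards [hae] with ω hω
    exact rankError_eq_pos _ hω s
  rw [Measure.map_congr e, h1.2, h.map_wordAfter hA hI s]
  exact ⟨h1.1.congr e.symm, rfl⟩

lemma IsInput.map_rankError [NeZero n] (h : IsInput σ μ A I) (s : ℕ) :
    AEMeasurable (fun ω => rankError (fun k => A k ω) (fun t => I t ω) s) μ ∧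
    μ.map (fun ω => rankError (fun k => A k ω) (fun t => I t ω) s) =
      ∑ i, σ i • ((step σ)^[s] (iid n)).map (pos i) := by
  -- pass to measurable versions of the input variables
  have hA := fun k => (h.law_element k).aemeasurable
  have hI := fun t => (h.law_choice t).aemeasurable
  have h' : IsInput σ μ (fun k => (hA k).mk) (fun t => (hI t).mk) := by
    refine ⟨fun k => (h.law_element k).congr (hA k).ae_eq_mk.symm,
      fun t => (h.law_choice t).congr (hI t).ae_eq_mk.symm, ?_⟩
    refine h.indep.congr ?_
    rintro (k | t)
    · exact (hA k).ae_eq_mk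
    · exact (hI t).ae_eq_mk
  have h1 := h'.map_rankError_of_measurable (fun k => (hA k).measurable_mk)
    (fun t => (hI t).measurable_mk) s
  have e : (fun ω => rankError (fun k => A k ω) (fun t => I t ω) s) =ᵐ[μ]
      fun ω => rankError (fun k => (hA k).mk _ ω) (fun t => (hI t).mk _ ω) s := by
    filter_upwards [ae_all_iff.2 fun k => (hA k).ae_eq_mk,
      ae_all_iff.2 fun t => (hI t).ae_eq_mk] with ω h1 h2
    simp only [h1, h2]
  rw [Measure.map_congr e]
  exact ⟨h1.1.congr e.symm, h1.2⟩

end Input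

/-! ### Geometric random variables and the limiting rank -/

lemma lintegral_geomOne {p : unitInterval} (hp : p ≠ 0) (G : ℕ → ℝ≥0∞) :
    ∫⁻ d, G d ∂geomOne p = ∑' k : ℕ, ENNReal.ofReal ((1 - p) ^ k * p) * G (k + 1) := by
  rw [geomOne, lintegral_map .of_discrete .of_discrete, geometricMeasure_eq hp,
    lintegral_sum_measure]
  simp

/-- The first trial of a geometric random variable is either a success or can be discarded. -/
lemma lintegral_geomOne_eq {p : unitInterval} (hp : p ≠ 0) (G : ℕ → ℝ≥0∞) :
    ∫⁻ d, G d ∂geomOne p = ENNReal.ofReal (1 - p) * ∫⁻ d, G (d + 1) ∂geomOne p +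
      ENNReal.ofReal p * G 1 := by
  rw [lintegral_geomOne hp, lintegral_geomOne hp, tsum_eq_zero_add' ENNReal.summable,
    ← ENNReal.tsum_mul_left, add_comm]
  have h0 : (0 : ℝ) ≤ 1 - p := sub_nonneg.2 p.2.2
  congr 1
  · refine tsum_congr fun k => ?_
    rw [← mul_assoc, ← ENNReal.ofReal_mul h0]
    ring_nf
  · simp

lemma geomOne_singleton_zero (p : unitInterval) : geomOne p {0} = 0 := by
  rw [geomOne, Measure.map_apply .of_discrete (measurableSet_singleton 0)]
  have : (fun k : ℕ => k + 1) ⁻¹' {0} = ∅ := by ext; simp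
  rw [this, measure_empty]

instance (p : unitInterval) : IsProbabilityMeasure (geomOne p) := by
  unfold geomOne
  exact Measure.isProbabilityMeasure_map Measurable.of_discrete.aemeasurable

lemma integrable_geomOne {p : unitInterval} (hp : p ≠ 0) :
    Integrable (fun d : ℕ => (d : ℝ)) (geomOne p) ∧ ∫ d, (d : ℝ) ∂geomOne p = 1 / p := by
  have hp0 : (0 : ℝ) < p := lt_of_le_of_ne p.2.1 fun h => hp (Subtype.ext h.symm)
  have h1 : ‖(1 - p : ℝ)‖ < 1 := by
    rw [Real.norm_eq_abs, abs_lt]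
    constructor <;> linarith [p.2.2]
  have hs : HasSum (fun k : ℕ => (1 - p : ℝ) ^ k * p * ((k + 1 : ℕ) : ℝ)) (1 / p) := by
    have h2 := ((hasSum_coe_mul_geometric_of_norm_lt_one h1).add
      (hasSum_geometric_of_norm_lt_one h1)).mul_left (p : ℝ)
    have e1 : ∀ k : ℕ, (1 - p : ℝ) ^ k * p * ((k + 1 : ℕ) : ℝ) =
        p * (k * (1 - p : ℝ) ^ k + (1 - p : ℝ) ^ k) := fun k => by
      push_cast
      ring
    have e2 : 1 / (p : ℝ) =
        p * ((1 - p : ℝ) / (1 - (1 - p : ℝ)) ^ 2 + (1 - (1 - p : ℝ))⁻¹) := by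
      rw [sub_sub_cancel]
      field_simp
      ring
    rw [e2, funext e1]
    exact h2
  have hint : Integrable (fun k : ℕ => ((k + 1 : ℕ) : ℝ)) (geometricMeasure p) := by
    rw [integrable_geometricMeasure_iff hp]
    convert hs.summable using 2 with k
    rw [Real.norm_of_nonneg (by positivity)]
  rw [geomOne, integrable_map_measure .of_discrete Measurable.of_discrete.aemeasurable,
    integral_map Measurable.of_discrete.aemeasurable .of_discrete]
  refine ⟨hint, ?_⟩
  rw [integral_geometricMeasure hp]
  exact hs.tsum_eq

/-- The tail of the sum of a geometric random variable and an independent one. -/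
lemma measure_succ_lt_add {Ω : Type*} [MeasurableSpace Ω] {μ : Measure Ω} [IsProbabilityMeasure μ]
    {p : unitInterval} (hp : p ≠ 0) {D Y : Ω → ℕ} (hD : HasLaw D (geomOne p) μ)
    (hY : AEMeasurable Y μ) (h : IndepFun D Y μ) (m : ℕ) :
    μ {ω | m + 1 < D ω + Y ω} = ENNReal.ofReal (1 - p) * μ {ω | m < D ω + Y ω} +
      ENNReal.ofReal p * μ {ω | m < Y ω} := by
  have hprod := (indepFun_iff_map_prod_eq_prod_map_map hD.aemeasurable hY).1 h
  rw [hD.map_eq] at hprod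
  have := Measure.isProbabilityMeasure_map hY
  have key : ∀ m, μ {ω | m < D ω + Y ω} = ∫⁻ d, μ.map Y {y | m < d + y} ∂geomOne p := by
    intro m
    have hm : MeasurableSet {q : ℕ × ℕ | m < q.1 + q.2} := .of_discrete
    rw [show {ω | m < D ω + Y ω} = (fun ω => (D ω, Y ω)) ⁻¹' {q : ℕ × ℕ | m < q.1 + q.2} from rfl,
      ← Measure.map_apply_of_aemeasurable (hD.aemeasurable.prodMk hY) hm, hprod,
      Measure.prod_apply hm]
    rfl
  have h1 : μ {ω | m < Y ω} = μ.map Y {y | m + 1 < 1 + y} := by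
    rw [Measure.map_apply_of_aemeasurable hY .of_discrete]
    congr 1
    ext ω
    simp only [Set.mem_ofPred_eq, Set.mem_preimage]
    omega
  rw [key, key, lintegral_geomOne_eq hp, h1]
  congr 3
  funext d
  congr 1
  ext y
  simp only [Set.mem_ofPred_eq]
  omega

lemma one_sub_successProb {σ : PMF (Fin n)} (hσ : Star σ) (j : Fin (n - 1)) :
    1 - (successProb σ hσ j : ℝ) = ((j.val + 1 : ℕ) : ℝ) / (n * cum σ (j.val + 1)) := by
  simp [successProb]

lemma successProb_ne_zero {σ : PMF (Fin n)} (hσ : Star σ) (j : Fin (n - 1)) :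
    successProb σ hσ j ≠ 0 := by
  intro h
  have h1 := one_sub_successProb hσ j
  have h2 := hσ.lt_mul_cum (a := j.val + 1) (by omega) (by omega)
  rw [h] at h1
  have h3 : (0 : ℝ) < ((j.val + 1 : ℕ) : ℝ) := by positivity
  rw [eq_div_iff (by linarith)] at h1
  simp only [Set.Icc.coe_zero, sub_zero, one_mul] at h1
  linarith

section Limit

variable {σ : PMF (Fin n)} {hσ : Star σ} {Ω : Type*} [MeasurableSpace Ω] {μ : Measure Ω}
  [IsProbabilityMeasure μ] {δ : Fin (n - 1) → Ω → ℕ}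

/-- The stationary position of the first occurrence of the `i`-th distinct letter is distributed
as a sum of independent geometric random variables. -/
lemma map_pos_stat [NeZero n] (hδ : ∀ j, HasLaw (δ j) (geomOne (successProb σ hσ j)) μ)
    (hind : iIndepFun δ μ) (i : Fin n) :
    (stat σ).map (pos i) = μ.map (fun ω => limitRank (fun j => δ j ω) i - 1) := by
  have := isProbabilityMeasure_stat hσ
  have hm : ∀ j, AEMeasurable (δ j) μ := fun j => (hδ j).aemeasurable
  set S : ℕ → Finset (Fin (n - 1)) := fun a =>
    Finset.univ.filter fun j => a ≤ j.val + 1 ∧ j.val < i.val with hS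
  set H : ℕ → Ω → ℕ := fun a ω => ∑ j ∈ S a, δ j ω with hH
  have hHm : ∀ a, AEMeasurable (H a) μ := fun a => Finset.aemeasurable_fun_sum _ fun j _ => hm j
  have hlim : ∀ ω, limitRank (fun j => δ j ω) i - 1 = H 1 ω := by
    intro ω
    simp [limitRank, hH, hS]
  simp only [hlim]
  have hsplit : ∀ (j : Fin (n - 1)), j.val < i.val →
      S (j.val + 1) = insert j (S (j.val + 2)) ∧ j ∉ S (j.val + 2) := by
    intro j hj
    constructor
    · ext k
      simp only [hS, Finset.mem_filter, Finset.mem_univ, true_and, Finset.mem_insert, Fin.ext_iff]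
      omega
    · simp [hS]
  have hHsplit : ∀ (j : Fin (n - 1)), j.val < i.val → ∀ ω,
      H (j.val + 1) ω = δ j ω + H (j.val + 2) ω := by
    intro j hj ω
    simp only [hH]
    rw [(hsplit j hj).1, Finset.sum_insert (hsplit j hj).2]
  -- the tails satisfy the recursion of the pure birth chain; `a = 0` accounts for the first
  -- letter, which is always new
  set h : ℕ → ℕ → ℝ≥0∞ := fun a m => if a = 0 then μ {ω | m ≤ H 1 ω} else μ {ω | m < H a ω} with hh
  have h0 : ∀ a ≤ i.val, h a 0 = 1 := by
    intro a ha
    rcases a with _ | a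
    · simp [hh]
    · have ha' : a < n - 1 := by omega
      simp only [hh, Nat.add_eq_zero_iff, one_ne_zero, and_false, if_false]
      rw [← measure_univ (μ := μ)]
      refine measure_congr (eventuallyEq_univ.2 ?_)
      have h1 : ∀ᵐ ω ∂μ, δ ⟨a, ha'⟩ ω ≠ 0 := by
        have h2 : μ.map (δ ⟨a, ha'⟩) {0} = 0 := by
          rw [(hδ _).map_eq, geomOne_singleton_zero]
        rw [Measure.map_apply_of_aemeasurable (hm _) (measurableSet_singleton 0)] at h2
        rw [ae_iff]
        simpa [Set.preimage] using h2
      filter_upwards [h1] with ω hω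
      have := hHsplit ⟨a, ha'⟩ (by simp; omega) ω
      simp only at this ⊢
      omega
  have hi : ∀ a, i.val < a → ∀ m, h a m = 0 := by
    intro a ha m
    have hSa : S a = ∅ := by
      refine Finset.filter_eq_empty_iff.2 fun j _ hj => ?_
      omega
    simp [hh, hH, hSa, show a ≠ 0 by omega]
  have hs : ∀ a ≤ i.val, ∀ m,
      h a (m + 1) = oldProb σ a * h a m + (1 - oldProb σ a) * h (a + 1) m := by
    intro a ha m
    rcases a with _ | a
    · simp [hh, oldProb_zero]
    · have ha' : a < n - 1 := by omega
      have hp : oldProb σ (a + 1) = ENNReal.ofReal (1 - successProb σ hσ ⟨a, ha'⟩) := by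
        rw [oldProb_eq_ofReal hσ (by omega), one_sub_successProb]
      have hp' : 1 - oldProb σ (a + 1) = ENNReal.ofReal (successProb σ hσ ⟨a, ha'⟩) := by
        rw [hp, ← ENNReal.ofReal_one,
          ← ENNReal.ofReal_sub _ (sub_nonneg.2 (successProb σ hσ _).2.2)]
        congr 1
        ring
      have hindep : IndepFun (δ ⟨a, ha'⟩) (H (a + 2)) μ := by
        have h1 := (hind.indepFun_finsetSum_of_notMem₀ hm
          (hsplit ⟨a, ha'⟩ (by simp; omega)).2).symm
        have h2 : ∑ j ∈ S (a + 2), δ j = H (a + 2) := by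
          funext ω
          simp [hH]
        rwa [← h2]
      have h3 := measure_succ_lt_add (successProb_ne_zero hσ ⟨a, ha'⟩) (hδ ⟨a, ha'⟩) (hHm (a + 2))
        hindep m
      simp only [← hHsplit ⟨a, ha'⟩ (by simp; omega)] at h3
      simp only [hh, Nat.add_eq_zero_iff, one_ne_zero, and_false, if_false]
      rw [hp', hp]
      exact h3
  have := Measure.isProbabilityMeasure_map (hHm 1)
  have := Measure.isProbabilityMeasure_map (μ := stat σ) (measurable_pos i.val).aemeasurable
  refine Measure.ext_of_Ici _ _ fun m => ?_
  rw [Measure.map_apply (measurable_pos i) measurableSet_Ici,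
    Measure.map_apply_of_aemeasurable (hHm 1) measurableSet_Ici]
  exact stat_le_pos hσ i h0 hi hs m

end Limit

/-! ### The expectation of the limit and the convergence in distribution -/

/-- The probability that `σ` selects an index above `j`. -/
lemma integral_indicator_lt {σ : PMF (Fin n)} {Ω : Type*} [MeasurableSpace Ω] {μ : Measure Ω}
    [IsProbabilityMeasure μ] {X : Ω → Fin n} (hX : HasLaw X σ.toMeasure μ) (j : ℕ) :
    ∫ ω, (if j < (X ω).val then (1 : ℝ) else 0) ∂μ = 1 - cum σ (j + 1) := by
  have h := hX.integral_comp (f := fun i : Fin n => if j < i.val then (1 : ℝ) else 0)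
    .of_discrete
  rw [Function.comp_def] at h
  rw [h, PMF.integral_eq_sum]
  have h1 : ∑ i, (σ i).toReal = 1 := by
    rw [← ENNReal.toReal_sum fun i _ => σ.apply_ne_top i,
      ← tsum_fintype (L := SummationFilter.unconditional _), σ.tsum_coe, ENNReal.toReal_one]
  rw [eq_sub_iff_add_eq, cum, Finset.sum_filter, ← Finset.sum_add_distrib]
  refine (Finset.sum_congr rfl fun i _ => ?_).trans h1
  by_cases hi : j < i.val
  · simp [hi, show ¬ i.val < j + 1 by omega]
  · simp [hi, show i.val < j + 1 by omega]

lemma integrable_limitRank {σ : PMF (Fin n)} (hσ : Star σ) {Ω : Type*} [MeasurableSpace Ω]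
    {μ : Measure Ω} [IsProbabilityMeasure μ] {δ : Fin (n - 1) → Ω → ℕ} {X : Ω → Fin n}
    (hδ : ∀ j, HasLaw (δ j) (geomOne (successProb σ hσ j)) μ) (hX : HasLaw X σ.toMeasure μ)
    (hind : IndepFun X (fun ω j => δ j ω) μ) :
    Integrable (fun ω => ((limitRank (fun j => δ j ω) (X ω) - 1 : ℕ) : ℝ)) μ ∧
    ∫ ω, ((limitRank (fun j => δ j ω) (X ω) - 1 : ℕ) : ℝ) ∂μ =
      ∑ i ∈ Finset.Icc 1 (n - 1), cum σ i * (1 - cum σ i) / (cum σ i - (i : ℝ) / n) := by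
  have e : ∀ ω, ((limitRank (fun j => δ j ω) (X ω) - 1 : ℕ) : ℝ) =
      ∑ j : Fin (n - 1), (if j.val < (X ω).val then (1 : ℝ) else 0) * (δ j ω : ℝ) := by
    intro ω
    simp [limitRank, Finset.sum_filter]
  have hd : ∀ j, Integrable (fun ω => (δ j ω : ℝ)) μ ∧
      ∫ ω, (δ j ω : ℝ) ∂μ = 1 / (successProb σ hσ j : ℝ) := by
    intro j
    have h := integrable_geomOne (successProb_ne_zero hσ j)
    rw [← (hδ j).map_eq, integrable_map_measure .of_discrete (hδ j).aemeasurable,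
      integral_map (hδ j).aemeasurable .of_discrete] at h
    exact h
  have hx : ∀ j : ℕ, Integrable (fun ω => if j < (X ω).val then (1 : ℝ) else 0) μ := by
    intro j
    have hm : AEMeasurable (fun ω => if j < (X ω).val then (1 : ℝ) else 0) μ :=
      (Measurable.of_discrete
        (f := fun i : Fin n => if j < i.val then (1 : ℝ) else 0)).comp_aemeasurable hX.aemeasurable
    refine Integrable.of_bound hm.aestronglyMeasurable 1 (.of_forall fun ω => ?_)
    split_ifs <;> simp
  have hi : ∀ j : Fin (n - 1), IndepFun (fun ω => if j.val < (X ω).val then (1 : ℝ) else 0)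
      (fun ω => (δ j ω : ℝ)) μ := fun j =>
    hind.comp (φ := fun i : Fin n => if j.val < i.val then (1 : ℝ) else 0)
      (ψ := fun d : Fin (n - 1) → ℕ => (d j : ℝ)) .of_discrete
      (Measurable.of_discrete.comp (measurable_pi_apply j))
  have hprod : ∀ j : Fin (n - 1), Integrable
      (fun ω => (if j.val < (X ω).val then (1 : ℝ) else 0) * (δ j ω : ℝ)) μ := fun j =>
    (hi j).integrable_mul (hx j) (hd j).1
  simp only [e]
  refine ⟨integrable_finsetSum _ fun j _ => hprod j, ?_⟩
  rw [integral_finsetSum _ fun j _ => hprod j]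
  have hterm : ∀ j : Fin (n - 1),
      ∫ ω, (if j.val < (X ω).val then (1 : ℝ) else 0) * (δ j ω : ℝ) ∂μ =
      cum σ (j.val + 1) * (1 - cum σ (j.val + 1)) /
        (cum σ (j.val + 1) - ((j.val + 1 : ℕ) : ℝ) / n) := by
    intro j
    rw [(hi j).integral_fun_mul_eq_mul_integral (hx j).aestronglyMeasurable
      (hd j).1.aestronglyMeasurable, integral_indicator_lt hX, (hd j).2]
    have h2 := hσ.lt_mul_cum (a := j.val + 1) (by omega) (by omega)
    have hn0 : 0 < n := by have := j.isLt; omega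
    have hn : (0 : ℝ) < n := by exact_mod_cast hn0
    have h3 : (0 : ℝ) < ((j.val + 1 : ℕ) : ℝ) := by positivity
    have hc : cum σ (j.val + 1) ≠ 0 := fun h => by
      rw [h] at h2
      linarith
    have h4 : (n : ℝ) * cum σ (j.val + 1) - ((j.val + 1 : ℕ) : ℝ) ≠ 0 := by linarith
    have h5 : (successProb σ hσ j : ℝ) =
        (cum σ (j.val + 1) - ((j.val + 1 : ℕ) : ℝ) / n) / cum σ (j.val + 1) := by
      rw [← sub_sub_cancel (1 : ℝ) (successProb σ hσ j : ℝ), one_sub_successProb]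
      field_simp
    rw [h5, one_div_div]
    ring
  rw [Finset.sum_congr rfl fun j _ => hterm j,
    ← Finset.sum_range fun j => cum σ (j + 1) * (1 - cum σ (j + 1)) /
        (cum σ (j + 1) - ((j + 1 : ℕ) : ℝ) / n), Finset.range_eq_Ico,
    Finset.sum_Ico_add' (fun i : ℕ => cum σ i * (1 - cum σ i) / (cum σ i - (i : ℝ) / n))]
  rfl

/-- The rank error converges in distribution to `r_{i*} - 1`. -/
lemma tendstoInDistribution_rankError [NeZero n] {σ : PMF (Fin n)} (hσ : Star σ)
    {Ω : Type*} [MeasurableSpace Ω] {μ : Measure Ω} [IsProbabilityMeasure μ]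
    {A I : ℕ → Ω → Fin n} (hAI : IsInput σ μ A I)
    {Ω' : Type*} [MeasurableSpace Ω'] {μ' : Measure Ω'} [IsProbabilityMeasure μ']
    {δ : Fin (n - 1) → Ω' → ℕ} {X : Ω' → Fin n}
    (hδ : ∀ j, HasLaw (δ j) (geomOne (successProb σ hσ j)) μ') (hδ_indep : iIndepFun δ μ')
    (hX : HasLaw X σ.toMeasure μ') (hind : IndepFun X (fun ω j => δ j ω) μ') :
    TendstoInDistribution (fun s ω => rankError (fun k => A k ω) (fun t => I t ω) s) atTop
      (fun ω => limitRank (fun j => δ j ω) (X ω) - 1) (fun _ => μ) μ' := by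
  have hδm : AEMeasurable (fun ω j => δ j ω) μ' :=
    aemeasurable_pi_iff.2 fun j => (hδ j).aemeasurable
  have hlim : ∀ i : Fin n, Measurable fun d : Fin (n - 1) → ℕ => limitRank d i - 1 := fun i =>
    .of_discrete
  have hE := map_eq_sum_of_indepFun hX hδm hind hlim
  refine ⟨fun s => (hAI.map_rankError s).1, hE.1, ?_⟩
  refine tendsto_of_forall_isOpen_le_liminf' fun G _ => ?_
  have hlaw : μ'.map (fun ω => limitRank (fun j => δ j ω) (X ω) - 1) =
      ∑ i, σ i • (stat σ).map (pos i) := by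
    rw [hE.2]
    refine Finset.sum_congr rfl fun i _ => ?_
    rw [map_pos_stat hδ hδ_indep i, AEMeasurable.map_map_of_aemeasurable
      (hlim i).aemeasurable hδm]
    rfl
  refine (Tendsto.liminf_eq ?_).ge
  simp only [ProbabilityMeasure.coe_mk, hlaw, (hAI.map_rankError _).2, Measure.finsetSum_apply,
    Measure.smul_apply, smul_eq_mul]
  refine tendsto_finsetSum _ fun i _ => ENNReal.Tendsto.const_mul ?_ (.inr (σ.apply_ne_top i))
  simp only [Measure.map_apply (measurable_pos _) (MeasurableSet.of_discrete (s := G))]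
  exact tendsto_iterate_step hσ _

end MultiQueue

theorem corollary2 {n : ℕ} (σ : PMF (Fin n)) (hσ : MultiQueue.Star σ)
    -- the `σ`-MultiQueue
    {Ω : Type*} [MeasurableSpace Ω] (μ : Measure Ω) [IsProbabilityMeasure μ]
    (A I : ℕ → Ω → Fin n) (hAI : MultiQueue.IsInput σ μ A I)
    -- the random variables that define the limit `E = r_{i*} - 1`
    {Ω' : Type*} [MeasurableSpace Ω'] (μ' : Measure Ω') [IsProbabilityMeasure μ']
    (δ : Fin (n - 1) → Ω' → ℕ) (istar : Ω' → Fin n)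
    (hδ : ∀ j, HasLaw (δ j) (MultiQueue.geomOne (MultiQueue.successProb σ hσ j)) μ')
    (hδ_indep : iIndepFun δ μ')
    (histar : HasLaw istar σ.toMeasure μ')
    (h_indep : IndepFun istar (fun ω j => δ j ω) μ')
    (E : Ω' → ℕ) (hE : ∀ ω, E ω = MultiQueue.limitRank (fun j => δ j ω) (istar ω) - 1) :
    TendstoInDistribution
      (fun s ω => MultiQueue.rankError (fun k => A k ω) (fun t => I t ω) s)
      atTop E (fun _ => μ) μ' ∧
    Integrable (fun ω => (E ω : ℝ)) μ' ∧
    ∫ ω, (E ω : ℝ) ∂μ' =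
      ∑ i ∈ Finset.Icc 1 (n - 1),
        MultiQueue.cum σ i * (1 - MultiQueue.cum σ i) / (MultiQueue.cum σ i - (i : ℝ) / n) := by
  obtain ⟨i₀, -⟩ := σ.support_nonempty
  have : NeZero n := ⟨by have := i₀.isLt; omega⟩
  obtain rfl : E = fun ω => MultiQueue.limitRank (fun j => δ j ω) (istar ω) - 1 := funext hE
  exact ⟨MultiQueue.tendstoInDistribution_rankError hσ hAI hδ hδ_indep histar h_indep,
    MultiQueue.integrable_limitRank hσ hδ histar h_indep⟩
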